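/- Let $\Bbbk$ be a field. For a bialgebra $H$ over $\Bbbk$ and $T=\sum_i T^i\otimes T_i\in H\otimes H$ write $T^{\mathrm{op}}=\sum_i T_i\otimes T^i$, $T_{12}=T\otimes 1$, $T_{23}=1\otimes T$, $T_{13}=\sum_i T^i\otimes 1\otimes T_i$. A triangular bialgebra $(H,\mathcal R)$ is a bialgebra $H$ over $\Bbbk$ with an invertible $\mathcal R\in H\otimes H$ such that $\Delta^{\mathrm{op}}(x)=\mathcal R\Delta(x)\mathcal R^{-1}$ for all $x\in H$, $(\mathrm{Id}\otimes\Delta)(\mathcal R)=\mathcal R_{13}\mathcal R_{12}$, $(\Delta\otimes\mathrm{Id})(\mathcal R)=\mathcal R_{13}\mathcal R_{23}$ and $\mathcal R^{-1}=\mathcal R^{\mathrm{op}}$. A twist on $H$ is an invertible $\mathcal F\in H\otimes H$ with $(\mathcal F\otimes 1)(\Delta\otimes\mathrm{Id})(\mathcal F)=(1\otimes\mathcal F)(\mathrm{Id}\otimes\Delta)(\mathcal F)$ and $(\varepsilon\otimes\mathrm{Id})(\mathcal F)=1=(\mathrm{Id}\otimes\varepsilon)(\mathcal F)$. Let $\mathsf{TwTr}$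 be the following (strict) 2-category. Its 0-cells are the triangular bialgebras over $\Bbbk$. A 1-cell $(H,\mathcal R)\to(H',\mathcal R')$ is a pair $(f,\mathcal F)$ of a twist $\mathcal F$ on $H'$ and an algebra map $f:H\to H'$ with $\varepsilon' f=\varepsilon$, $\mathcal F\Delta'(f(x))\mathcal F^{-1}=(f\otimes f)\Delta(x)$ for all $x\in H$, and $(f\otimes f)(\mathcal R)=\mathcal F^{\mathrm{op}}\mathcal R'\mathcal F^{-1}$. A 2-cell $(f,\mathcal F)\Rightarrow(f',\mathcal F')$ between such 1-cells is an element $a\in H'$ with $\varepsilon'(a)=1$, $(a\otimes a)\mathcal F=\mathcal F'\Delta'(a)$, and $af(x)=f'(x)a$ for all $x\in H$. Composition of 1-cells is $(g,\mathcal G)\circ(f,\mathcal F)=(gf,(g\otimes g)(\mathcal F)\mathcal G)$ with identities $(\mathrm{Id},1\otimes 1)$; the vertical composite of $b:(f,\mathcal F)\Rightarrow(f',\mathcal F')$ followed by $a:(f',\mathcal F')\Rightarrow(f'',\mathcal F'')$ is $ab$; and the horizontal composite of $b:(f,\mathcal F)\Rightarrow(f',\mathcal F')$ followed by $a:(g,\mathcal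 G)\Rightarrow(g',\mathcal G')$ is $a\,g(b)$. Then $\mathsf{TwTr}$ has all finite products: for every finite family $(A_i)_{i\in I}$ of 0-cells there are a 0-cell $P$ and 1-cells $\pi_i:P\to A_i$ such that, for every 0-cell $X$, the functor $\mathsf{TwTr}(X,P)\to\prod_{i\in I}\mathsf{TwTr}(X,A_i)$ given by composition with the $\pi_i$ is an equivalence of categories. Moreover: - $(\Bbbk,1\otimes 1)$ is a terminal object: for every 0-cell $X$ the functor from $\mathsf{TwTr}(X,(\Bbbk,1\otimes 1))$ to the terminal category is an equivalence of categories; - for all 0-cells $(H_1,\mathcal R_1)$ and $(H_2,\mathcal R_2)$, the triangular bialgebra $\big(H_1\otimes H_2,(\mathrm{Id}\otimes\tau\otimes\mathrm{Id})(\mathcal R_1\otimes\mathcal R_2)\big)$, where $\tau$ is the flip, with the projections $(\mathrm{Id}\otimes\varepsilon,1\otimes 1)$ and $(\varepsilon\otimes\mathrm{Id},1\otimes 1)$, is a binary product: for every 0-cell $X$, composition with the two projections is an equivalence of categories from $\mathsf{TwTr}(X,H_1\otimes H_2)$ to $\mathsf{TwTr}(X,H_1)\times\mathsf{TwTr}(X,H_2)$.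 -/

import Mathlib

open scoped TensorProduct
open CategoryTheory

universe u w

noncomputable section

namespace TwistedTriangular

/-! ### Algebra maps between tensor powers -/

section Maps

variable (k : Type u) [Field k] (A B : Type u) [Ring A] [Ring B] [Bialgebra k A] [Bialgebra k B]

/-- The flip `a ⊗ b ↦ b ⊗ a` on `A ⊗ A`; the image of `T` is `T^op`. -/
def op : A ⊗[k] A →ₐ[k] A ⊗[k] A := (Algebra.TensorProduct.comm k A A).toAlgHom

/-- The map `Id ⊗ ε : A ⊗ B → A`. -/
def idCounit : A ⊗[k] B →ₐ[k] A :=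
  (Algebra.TensorProduct.rid k k A).toAlgHom.comp
    (Algebra.TensorProduct.map (AlgHom.id k A) (Bialgebra.counitAlgHom k B))

/-- The map `ε ⊗ Id : A ⊗ B → B`. -/
def counitId : A ⊗[k] B →ₐ[k] B :=
  (Algebra.TensorProduct.lid k B).toAlgHom.comp
    (Algebra.TensorProduct.map (Bialgebra.counitAlgHom k A) (AlgHom.id k B))

/-- `T ↦ T₁₂ = T ⊗ 1`, with values in `A ⊗ (A ⊗ A)`. -/
def leg12 : A ⊗[k] A →ₐ[k] A ⊗[k] (A ⊗[k] A) :=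
  Algebra.TensorProduct.map (AlgHom.id k A) Algebra.TensorProduct.includeLeft

/-- `T ↦ T₁₃`, sending `a ⊗ b` to `a ⊗ 1 ⊗ b`. -/
def leg13 : A ⊗[k] A →ₐ[k] A ⊗[k] (A ⊗[k] A) :=
  Algebra.TensorProduct.map (AlgHom.id k A) Algebra.TensorProduct.includeRight

/-- `T ↦ T₂₃ = 1 ⊗ T`. -/
def leg23 : A ⊗[k] A →ₐ[k] A ⊗[k] (A ⊗[k] A) := Algebra.TensorProduct.includeRight

/-- The map `Δ ⊗ Id`, with values reassociated into `A ⊗ (A ⊗ A)`. -/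
def comulId : A ⊗[k] A →ₐ[k] A ⊗[k] (A ⊗[k] A) :=
  (Algebra.TensorProduct.assoc k k k A A A).toAlgHom.comp
    (Algebra.TensorProduct.map (Bialgebra.comulAlgHom k A) (AlgHom.id k A))

/-- The map `Id ⊗ Δ`. -/
def idComul : A ⊗[k] A →ₐ[k] A ⊗[k] (A ⊗[k] A) :=
  Algebra.TensorProduct.map (AlgHom.id k A) (Bialgebra.comulAlgHom k A)

/-- The map `Id ⊗ τ ⊗ Id : (A ⊗ A) ⊗ (B ⊗ B) → (A ⊗ B) ⊗ (A ⊗ B)`. -/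
def middleFlip : (A ⊗[k] A) ⊗[k] (B ⊗[k] B) →ₐ[k] (A ⊗[k] B) ⊗[k] (A ⊗[k] B) :=
  (Algebra.TensorProduct.tensorTensorTensorComm k k k k A A B B).toAlgHom

end Maps

section Structures

variable (k : Type u) [Field k] {H : Type u} [Ring H] [Bialgebra k H]

/-- `R` is a triangular structure on the bialgebra `H`. -/
structure IsTriangularStructure (R : (H ⊗[k] H)ˣ) : Prop where
  quasi_cocomm : ∀ x : H,
    op k H (Bialgebra.comulAlgHom k H x) = R.val * Bialgebra.comulAlgHom k H x * R⁻¹.val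
  hexagon_right : idComul k H R.val = leg13 k H R.val * leg12 k H R.val
  hexagon_left : comulId k H R.val = leg13 k H R.val * leg23 k H R.val
  inv_eq_op : R⁻¹.val = op k H R.val

/-- `F` is a (Drinfeld) twist on the bialgebra `H`. -/
structure IsTwist (F : (H ⊗[k] H)ˣ) : Prop where
  cocycle : leg12 k H F.val * comulId k H F.val = leg23 k H F.val * idComul k H F.val
  counit_left : counitId k H H F.val = 1
  counit_right : idCounit k H H F.val = 1

end Structures

/-! ### The 2-category of triangular bialgebras and twisted morphisms -/

/-- The 0-cells: triangular bialgebras `(H, R)` over the field `k`. -/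
structure TwTr (k : Type u) [Field k] where
  carrier : Type u
  [ring : Ring carrier]
  [bialgebra : Bialgebra k carrier]
  R : (carrier ⊗[k] carrier)ˣ
  isTriangular : IsTriangularStructure k R

attribute [instance] TwTr.ring TwTr.bialgebra

variable {k : Type u} [Field k]

instance : CoeSort (TwTr k) (Type u) := ⟨TwTr.carrier⟩

/-- The 1-cells `(f, F) : (H, R) → (H', R')`: a twist `F` on `H'` and a morphism of triangular
bialgebras `f` from `(H, R)` to `(H'_F, R'_F)`, where `H'_F` is the algebra `H'` with the same
counit and the comultiplication `F Δ'(·) F⁻¹`, and where `R'_F = F^op R' F⁻¹`. -/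
@[ext]
structure TwistedHom (X Y : TwTr k) where
  f : X →ₐ[k] Y
  F : (Y ⊗[k] Y)ˣ
  isTwist : IsTwist k F
  counit_comp : ∀ x : X, Bialgebra.counitAlgHom k Y (f x) = Bialgebra.counitAlgHom k X x
  comul_comp : ∀ x : X,
    F.val * Bialgebra.comulAlgHom k Y (f x) * F⁻¹.val =
      Algebra.TensorProduct.map f f (Bialgebra.comulAlgHom k X x)
  map_R : Algebra.TensorProduct.map f f X.R.val = op k Y F.val * Y.R.val * F⁻¹.val

/-- The 2-cells `(f, F) ⇒ (f', F')`: gauge transformations. -/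
@[ext]
structure Gauge {X Y : TwTr k} (p q : TwistedHom X Y) where
  a : Y
  counit_a : Bialgebra.counitAlgHom k Y a = 1
  gauge_twist : (a ⊗ₜ[k] a) * p.F.val = q.F.val * Bialgebra.comulAlgHom k Y a
  gauge_hom : ∀ x : X, a * p.f x = q.f x * a

section Lemmas

variable {A B : Type u} [Ring A] [Ring B] [Bialgebra k A] [Bialgebra k B]

lemma map_op (g : A →ₐ[k] B) (T : A ⊗[k] A) :
    Algebra.TensorProduct.map g g (op k A T) = op k B (Algebra.TensorProduct.map g g T) := by
  induction T with
  | zero => simp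
  | tmul x y => simp [op]
  | add x y hx hy => simp [hx, hy]

/-- The map `g ⊗ g ⊗ g`. -/
def map3 (g : A →ₐ[k] B) : A ⊗[k] (A ⊗[k] A) →ₐ[k] B ⊗[k] (B ⊗[k] B) :=
  Algebra.TensorProduct.map g (Algebra.TensorProduct.map g g)

lemma leg12_map (g : A →ₐ[k] B) (T : A ⊗[k] A) :
    leg12 k B (Algebra.TensorProduct.map g g T) = map3 g (leg12 k A T) := by
  induction T with
  | zero => simp
  | tmul x y => simp [leg12, map3]
  | add x y hx hy => simp [hx, hy]

lemma leg23_map (g : A →ₐ[k] B) (T : A ⊗[k] A) :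
    leg23 k B (Algebra.TensorProduct.map g g T) = map3 g (leg23 k A T) := by
  induction T with
  | zero => simp
  | tmul x y => simp [leg23, map3]
  | add x y hx hy => simp [hx, hy]

lemma assoc_leg (S : B ⊗[k] B) (b : B) :
    Algebra.TensorProduct.assoc k k k B B B (S ⊗ₜ[k] b) =
      leg12 k B S * leg23 k B ((1 : B) ⊗ₜ[k] b) := by
  induction S with
  | zero => simp
  | tmul x y => simp [leg12, leg23]
  | add x y hx hy => simp [TensorProduct.add_tmul, hx, hy, add_mul]

lemma comulId_map (g : A →ₐ[k] B) (G : (B ⊗[k] B)ˣ)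
    (h : ∀ x : A, G.val * Bialgebra.comulAlgHom k B (g x) * G⁻¹.val =
      Algebra.TensorProduct.map g g (Bialgebra.comulAlgHom k A x)) (T : A ⊗[k] A) :
    leg12 k B G.val * comulId k B (Algebra.TensorProduct.map g g T) =
      map3 g (comulId k A T) * leg12 k B G.val := by
  have h' : ∀ x : A, G.val * Bialgebra.comulAlgHom k B (g x) =
      Algebra.TensorProduct.map g g (Bialgebra.comulAlgHom k A x) * G.val := fun x ↦ by
    rw [← h]; simp [mul_assoc]
  have key : ∀ (S : A ⊗[k] A) (b : A),
      map3 g (Algebra.TensorProduct.assoc k k k A A A (S ⊗ₜ[k] b)) =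
        Algebra.TensorProduct.assoc k k k B B B
          (Algebra.TensorProduct.map g g S ⊗ₜ[k] g b) := by
    intro S b
    induction S with
    | zero => simp
    | tmul x y => simp [map3]
    | add x y hx hy => simp [TensorProduct.add_tmul, hx, hy]
  have comm : ∀ (S : B ⊗[k] B) (b : B),
      leg23 k B ((1 : B) ⊗ₜ[k] b) * leg12 k B S = leg12 k B S * leg23 k B ((1 : B) ⊗ₜ[k] b) := by
    intro S b
    induction S with
    | zero => simp
    | tmul x y => simp [leg12, leg23]
    | add x y hx hy => simp [mul_add, add_mul, hx, hy]
  induction T with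
  | zero => simp
  | tmul x y =>
    have e1 : comulId k B (Algebra.TensorProduct.map g g (x ⊗ₜ[k] y)) =
        leg12 k B (Bialgebra.comulAlgHom k B (g x)) * leg23 k B ((1 : B) ⊗ₜ[k] g y) := by
      rw [← assoc_leg]; simp [comulId]
    have e2 : map3 g (comulId k A (x ⊗ₜ[k] y)) =
        leg12 k B (Algebra.TensorProduct.map g g (Bialgebra.comulAlgHom k A x)) *
          leg23 k B ((1 : B) ⊗ₜ[k] g y) := by
      rw [← assoc_leg, ← key]; simp [comulId]
    rw [e1, e2, ← mul_assoc, ← map_mul, h', map_mul, mul_assoc, mul_assoc, comm]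
  | add x y hx hy => simp [mul_add, add_mul, hx, hy]

lemma idComul_map (g : A →ₐ[k] B) (G : (B ⊗[k] B)ˣ)
    (h : ∀ x : A, G.val * Bialgebra.comulAlgHom k B (g x) * G⁻¹.val =
      Algebra.TensorProduct.map g g (Bialgebra.comulAlgHom k A x)) (T : A ⊗[k] A) :
    leg23 k B G.val * idComul k B (Algebra.TensorProduct.map g g T) =
      map3 g (idComul k A T) * leg23 k B G.val := by
  have h' : ∀ x : A, G.val * Bialgebra.comulAlgHom k B (g x) =
      Algebra.TensorProduct.map g g (Bialgebra.comulAlgHom k A x) * G.val := fun x ↦ by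
    rw [← h]; simp [mul_assoc]
  induction T with
  | zero => simp
  | tmul x y =>
    have := h' y
    simp only [Bialgebra.comulAlgHom_apply] at this
    simp [leg23, idComul, map3, this]
  | add x y hx hy => simp [mul_add, add_mul, hx, hy]

lemma counitId_map (g : A →ₐ[k] B)
    (h : ∀ x : A, Bialgebra.counitAlgHom k B (g x) = Bialgebra.counitAlgHom k A x)
    (T : A ⊗[k] A) :
    counitId k B B (Algebra.TensorProduct.map g g T) = g (counitId k A A T) := by
  simp only [Bialgebra.counitAlgHom_apply] at h
  induction T with
  | zero => simp
  | tmul x y => simp [counitId, h]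
  | add x y hx hy => simp [hx, hy]

lemma idCounit_map (g : A →ₐ[k] B)
    (h : ∀ x : A, Bialgebra.counitAlgHom k B (g x) = Bialgebra.counitAlgHom k A x)
    (T : A ⊗[k] A) :
    idCounit k B B (Algebra.TensorProduct.map g g T) = g (idCounit k A A T) := by
  simp only [Bialgebra.counitAlgHom_apply] at h
  induction T with
  | zero => simp
  | tmul x y => simp [idCounit, h]
  | add x y hx hy => simp [hx, hy]

variable (k A) in
lemma isTwist_one : IsTwist k (1 : (A ⊗[k] A)ˣ) where
  cocycle := by simp
  counit_left := by simp
  counit_right := by simp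

end Lemmas

/-- The identity 1-cell `(Id, 1 ⊗ 1)`. -/
def TwistedHom.id (X : TwTr k) : TwistedHom X X where
  f := AlgHom.id k X
  F := 1
  isTwist := isTwist_one k X
  counit_comp _ := rfl
  comul_comp x := by simp
  map_R := by simp

/-- The composite of `p = (f, F)` and `q = (g, G)` is `(g ∘ f, (g ⊗ g)(F) G)`. -/
def TwistedHom.comp {X Y Z : TwTr k} (p : TwistedHom X Y) (q : TwistedHom Y Z) :
    TwistedHom X Z where
  f := q.f.comp p.f
  F := Units.map (Algebra.TensorProduct.map q.f q.f : Y ⊗[k] Y →* Z ⊗[k] Z) p.F * q.F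
  isTwist :=
    { cocycle := by
        simp only [Units.val_mul, Units.coe_map, MonoidHom.coe_coe, map_mul]
        have h1 := comulId_map q.f q.F q.comul_comp p.F.val
        have h2 := idComul_map q.f q.F q.comul_comp p.F.val
        rw [mul_assoc, ← mul_assoc (leg12 k Z q.F.val), h1, mul_assoc, ← mul_assoc,
          leg12_map, ← map_mul, p.isTwist.cocycle, q.isTwist.cocycle, map_mul,
          mul_assoc (leg23 k Z _), ← mul_assoc (leg23 k Z q.F.val), h2, leg23_map]
        simp only [mul_assoc]
      counit_left := by
        simp only [Units.val_mul, Units.coe_map, MonoidHom.coe_coe, map_mul]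
        rw [counitId_map q.f q.counit_comp, p.isTwist.counit_left, q.isTwist.counit_left]
        simp
      counit_right := by
        simp only [Units.val_mul, Units.coe_map, MonoidHom.coe_coe, map_mul]
        rw [idCounit_map q.f q.counit_comp, p.isTwist.counit_right, q.isTwist.counit_right]
        simp }
  counit_comp x := (q.counit_comp _).trans (p.counit_comp x)
  comul_comp x := by
    have h1 := q.comul_comp (p.f x)
    have h2 := p.comul_comp x
    have h3 : Algebra.TensorProduct.map (q.f.comp p.f) (q.f.comp p.f) =
        (Algebra.TensorProduct.map q.f q.f).comp (Algebra.TensorProduct.map p.f p.f) :=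
      Algebra.TensorProduct.map_comp _ _ _ _
    rw [h3]
    simp only [AlgHom.comp_apply]
    rw [← h2, map_mul, map_mul, ← h1, mul_inv_rev, ← map_inv]
    simp only [Units.val_mul, Units.coe_map, MonoidHom.coe_coe, mul_assoc]
  map_R := by
    have h3 : Algebra.TensorProduct.map (q.f.comp p.f) (q.f.comp p.f) =
        (Algebra.TensorProduct.map q.f q.f).comp (Algebra.TensorProduct.map p.f p.f) :=
      Algebra.TensorProduct.map_comp _ _ _ _
    rw [h3, AlgHom.comp_apply, p.map_R, map_mul, map_mul, q.map_R, map_op, mul_inv_rev, ← map_inv]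
    simp only [Units.val_mul, Units.coe_map, MonoidHom.coe_coe, mul_assoc, map_mul]

namespace Gauge

variable {X Y Z : TwTr k}

/-- The identity 2-cell, given by `1`. -/
def id (p : TwistedHom X Y) : Gauge p p where
  a := 1
  counit_a := map_one _
  gauge_twist := by simp [← Algebra.TensorProduct.one_def]
  gauge_hom x := by simp

/-- Vertical composition: first `b`, then `a`, is the product `a b`. -/
def vcomp {p q r : TwistedHom X Y} (b : Gauge p q) (a : Gauge q r) : Gauge p r where
  a := a.a * b.a
  counit_a := by rw [map_mul, a.counit_a, b.counit_a, one_mul]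
  gauge_twist := by
    rw [← Algebra.TensorProduct.tmul_mul_tmul, mul_assoc, b.gauge_twist, ← mul_assoc,
      a.gauge_twist, map_mul, mul_assoc]
  gauge_hom x := by rw [mul_assoc, b.gauge_hom, ← mul_assoc, a.gauge_hom, mul_assoc]

/-- Horizontal composition: `b : p ⇒ p'` followed by `a : q ⇒ q'` is `a g(b)`, where
`q = (g, G)`. -/
def hcomp {p p' : TwistedHom X Y} {q q' : TwistedHom Y Z} (b : Gauge p p') (a : Gauge q q') :
    Gauge (p.comp q) (p'.comp q') where
  a := a.a * q.f b.a
  counit_a := by rw [map_mul, a.counit_a, q.counit_comp, b.counit_a, one_mul]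
  gauge_twist := by
    have h : q.F.val * Bialgebra.comulAlgHom k Z (q.f b.a) =
        Algebra.TensorProduct.map q.f q.f (Bialgebra.comulAlgHom k Y b.a) * q.F.val := by
      rw [← q.comul_comp]; simp [mul_assoc]
    have h' : ∀ T : Y ⊗[k] Y, (a.a ⊗ₜ[k] a.a) * Algebra.TensorProduct.map q.f q.f T =
        Algebra.TensorProduct.map q'.f q'.f T * (a.a ⊗ₜ[k] a.a) := by
      intro T
      induction T with
      | zero => simp
      | tmul x y => simp [a.gauge_hom]
      | add x y hx hy => simp only [map_add, mul_add, add_mul, hx, hy]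
    have h2 := congrArg (Algebra.TensorProduct.map q.f q.f) b.gauge_twist
    rw [map_mul, map_mul, Algebra.TensorProduct.map_tmul] at h2
    simp only [TwistedHom.comp, Units.val_mul, Units.coe_map, MonoidHom.coe_coe, map_mul]
    rw [← Algebra.TensorProduct.tmul_mul_tmul, mul_assoc, ← mul_assoc (_ ⊗ₜ[k] _) _ q.F.val, h2,
      mul_assoc, ← h, ← mul_assoc, h', mul_assoc, ← mul_assoc (_ ⊗ₜ[k] _), a.gauge_twist]
    simp only [mul_assoc]
  gauge_hom x := by
    change a.a * q.f b.a * q.f (p.f x) = q'.f (p'.f x) * (a.a * q.f b.a)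
    rw [mul_assoc, ← map_mul, b.gauge_hom, map_mul, ← mul_assoc, a.gauge_hom, mul_assoc]

end Gauge

/-- 1-cells and 2-cells between two fixed 0-cells form a category under vertical composition. -/
instance (X Y : TwTr k) : Category (TwistedHom X Y) where
  Hom p q := Gauge p q
  id p := Gauge.id p
  comp b a := Gauge.vcomp b a
  id_comp _ := Gauge.ext (mul_one _)
  comp_id _ := Gauge.ext (one_mul _)
  assoc _ _ _ := Gauge.ext (mul_assoc _ _ _).symm

lemma TwistedHom.id_comp {X Y : TwTr k} (p : TwistedHom X Y) :
    (TwistedHom.id X).comp p = p := by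
  ext1
  · rfl
  · ext1
    simp [TwistedHom.comp, TwistedHom.id]

lemma TwistedHom.comp_id {X Y : TwTr k} (p : TwistedHom X Y) :
    p.comp (TwistedHom.id Y) = p := by
  ext1
  · rfl
  · ext1
    simp [TwistedHom.comp, TwistedHom.id]

lemma TwistedHom.assoc {X Y Z W : TwTr k} (p : TwistedHom X Y) (q : TwistedHom Y Z)
    (r : TwistedHom Z W) : (p.comp q).comp r = p.comp (q.comp r) := by
  ext1
  · rfl
  · ext1
    have h3 : Algebra.TensorProduct.map (r.f.comp q.f) (r.f.comp q.f) =
        (Algebra.TensorProduct.map r.f r.f).comp (Algebra.TensorProduct.map q.f q.f) :=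
      Algebra.TensorProduct.map_comp _ _ _ _
    simp [TwistedHom.comp, h3, mul_assoc]

/-- The element underlying the 2-cell `p ⇒ q` given by an equality `p = q`. -/
def eqA {X Y : TwTr k} {p q : TwistedHom X Y} (h : p = q) : Y :=
  Gauge.a (eqToHom h : p ⟶ q)

lemma eqA_eq_one {X Y : TwTr k} {p q : TwistedHom X Y} (h : p = q) : eqA h = 1 := by
  subst h
  rfl

/-- The 2-category `TwTr`: horizontal composition is `Gauge.hcomp`, whiskering is horizontal
composition with an identity 2-cell, and the coherence 2-cells are identities. -/
instance : Bicategory (TwTr k) where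
  Hom X Y := TwistedHom X Y
  id X := TwistedHom.id X
  comp p q := TwistedHom.comp p q
  homCategory _ _ := inferInstance
  whiskerLeft p _ _ a := Gauge.hcomp (Gauge.id p) a
  whiskerRight b q := Gauge.hcomp b (Gauge.id q)
  associator p q r := eqToIso (TwistedHom.assoc p q r)
  leftUnitor p := eqToIso (TwistedHom.id_comp p)
  rightUnitor p := eqToIso (TwistedHom.comp_id p)
  whiskerLeft_id _ q := Gauge.ext (by
    change 1 * q.f 1 = 1
    simp)
  whiskerLeft_comp _ q q' _ a b := Gauge.ext (by
    change (b.a * a.a) * q.f 1 = (b.a * q'.f 1) * (a.a * q.f 1)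
    simp)
  id_whiskerLeft {_ _ q q'} a := Gauge.ext (by
    change a.a * q.f 1 =
      eqA (TwistedHom.id_comp q').symm * a.a * eqA (TwistedHom.id_comp q)
    rw [eqA_eq_one, eqA_eq_one]
    simp)
  comp_whiskerLeft p q r r' a := Gauge.ext (by
    change a.a * r.f 1 = eqA (TwistedHom.assoc p q r').symm * (a.a * r.f 1 * r.f (q.f 1)) *
      eqA (TwistedHom.assoc p q r)
    rw [eqA_eq_one, eqA_eq_one]
    simp)
  id_whiskerRight _ q := Gauge.ext (by
    change 1 * q.f 1 = 1
    simp)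
  comp_whiskerRight b b' q := Gauge.ext (by
    change 1 * q.f (b'.a * b.a) = (1 * q.f b'.a) * (1 * q.f b.a)
    simp)
  whiskerRight_id {_ _ p p'} b := Gauge.ext (by
    change 1 * b.a =
      eqA (TwistedHom.comp_id p').symm * b.a * eqA (TwistedHom.comp_id p)
    rw [eqA_eq_one, eqA_eq_one]
    simp)
  whiskerRight_comp {_ _ _ _ p p'} b q r := Gauge.ext (by
    change 1 * r.f (q.f b.a) =
      eqA (TwistedHom.assoc p' q r) * (1 * r.f (1 * q.f b.a)) *
        eqA (TwistedHom.assoc p q r).symm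
    rw [eqA_eq_one, eqA_eq_one]
    simp)
  whisker_assoc p q q' b r := Gauge.ext (by
    change 1 * r.f (b.a * q.f 1) =
      eqA (TwistedHom.assoc p q' r).symm * (1 * r.f b.a * r.f (q.f 1)) *
        eqA (TwistedHom.assoc p q r)
    rw [eqA_eq_one, eqA_eq_one]
    simp)
  whisker_exchange {_ _ _ _ _ q q'} b a := Gauge.ext (by
    change 1 * q'.f b.a * (a.a * q.f 1) = a.a * q.f 1 * (1 * q.f b.a)
    simp [a.gauge_hom])
  pentagon p q r s := Gauge.ext (by
    change eqA (TwistedHom.assoc q r s) * s.f (r.f (q.f 1)) * eqA (TwistedHom.assoc p (q.comp r) s) *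
      (1 * s.f (eqA (TwistedHom.assoc p q r))) =
        eqA (TwistedHom.assoc p q (r.comp s)) * eqA (TwistedHom.assoc (p.comp q) r s)
    rw [eqA_eq_one, eqA_eq_one, eqA_eq_one, eqA_eq_one, eqA_eq_one]
    simp)
  triangle p q := Gauge.ext (by
    change eqA (TwistedHom.id_comp q) * q.f 1 * eqA (TwistedHom.assoc p (TwistedHom.id _) q) =
      1 * q.f (eqA (TwistedHom.comp_id p))
    rw [eqA_eq_one, eqA_eq_one, eqA_eq_one]
    simp)

instance : Bicategory.Strict (TwTr k) where
  id_comp := TwistedHom.id_comp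
  comp_id := TwistedHom.comp_id
  assoc := TwistedHom.assoc

/-! ### The terminal and the tensor product triangular bialgebras -/

variable (k) in
/-- The triangular bialgebra `(k, 1 ⊗ 1)`. -/
def unitObj : TwTr k where
  carrier := k
  R := 1
  isTriangular :=
    { quasi_cocomm := fun x ↦ by
        simpa [op] using Algebra.TensorProduct.tmul_one_eq_one_tmul (R := k) (A := k) (B := k) x
      hexagon_right := by simp
      hexagon_left := by simp
      inv_eq_op := by simp }

section Tensor

variable {A B : Type u} [Ring A] [Ring B] [Bialgebra k A] [Bialgebra k B]

/-- The map `(a ⊗ a' ⊗ a'') ⊗ (b ⊗ b' ⊗ b'') ↦ (a ⊗ b) ⊗ (a' ⊗ b') ⊗ (a'' ⊗ b'')`. -/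
def flip3 : (A ⊗[k] (A ⊗[k] A)) ⊗[k] (B ⊗[k] (B ⊗[k] B)) →ₐ[k]
    (A ⊗[k] B) ⊗[k] ((A ⊗[k] B) ⊗[k] (A ⊗[k] B)) :=
  (Algebra.TensorProduct.map (AlgHom.id k (A ⊗[k] B)) (middleFlip k A B)).comp
    (Algebra.TensorProduct.tensorTensorTensorComm k k k k A (A ⊗[k] A) B (B ⊗[k] B)).toAlgHom

/-- Two algebra maps out of `(A ⊗ A) ⊗ (B ⊗ B)` agree as soon as they agree on pure tensors. -/
lemma algHom_ext4 {C : Type u} [Ring C] [Algebra k C]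
    {φ ψ : (A ⊗[k] A) ⊗[k] (B ⊗[k] B) →ₐ[k] C}
    (h : ∀ (a a' : A) (b b' : B),
      φ ((a ⊗ₜ[k] a') ⊗ₜ[k] (b ⊗ₜ[k] b')) = ψ ((a ⊗ₜ[k] a') ⊗ₜ[k] (b ⊗ₜ[k] b'))) : φ = ψ := by
  apply AlgHom.toLinearMap_injective
  ext a a' b b'
  exact h a a' b b'

lemma leg12_flip (S : A ⊗[k] A) (T : B ⊗[k] B) :
    leg12 k (A ⊗[k] B) (middleFlip k A B (S ⊗ₜ[k] T)) =
      flip3 (leg12 k A S ⊗ₜ[k] leg12 k B T) := by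
  have : (leg12 k (A ⊗[k] B)).comp (middleFlip k A B) =
      flip3.comp (Algebra.TensorProduct.map (leg12 k A) (leg12 k B)) :=
    algHom_ext4 fun a a' b b' ↦ by simp [leg12, flip3, middleFlip, Algebra.TensorProduct.one_def]
  exact DFunLike.congr_fun this (S ⊗ₜ[k] T)

lemma leg13_flip (S : A ⊗[k] A) (T : B ⊗[k] B) :
    leg13 k (A ⊗[k] B) (middleFlip k A B (S ⊗ₜ[k] T)) =
      flip3 (leg13 k A S ⊗ₜ[k] leg13 k B T) := by
  have : (leg13 k (A ⊗[k] B)).comp (middleFlip k A B) =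
      flip3.comp (Algebra.TensorProduct.map (leg13 k A) (leg13 k B)) :=
    algHom_ext4 fun a a' b b' ↦ by simp [leg13, flip3, middleFlip, Algebra.TensorProduct.one_def]
  exact DFunLike.congr_fun this (S ⊗ₜ[k] T)

lemma leg23_flip (S : A ⊗[k] A) (T : B ⊗[k] B) :
    leg23 k (A ⊗[k] B) (middleFlip k A B (S ⊗ₜ[k] T)) =
      flip3 (leg23 k A S ⊗ₜ[k] leg23 k B T) := by
  have : (leg23 k (A ⊗[k] B)).comp (middleFlip k A B) =
      flip3.comp (Algebra.TensorProduct.map (leg23 k A) (leg23 k B)) :=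
    algHom_ext4 fun a a' b b' ↦ by simp [leg23, flip3, middleFlip, Algebra.TensorProduct.one_def]
  exact DFunLike.congr_fun this (S ⊗ₜ[k] T)

lemma comulAlgHom_tmul (a : A) (b : B) :
    Bialgebra.comulAlgHom k (A ⊗[k] B) (a ⊗ₜ[k] b) =
      middleFlip k A B (Bialgebra.comulAlgHom k A a ⊗ₜ[k] Bialgebra.comulAlgHom k B b) := rfl

lemma idComul_flip (S : A ⊗[k] A) (T : B ⊗[k] B) :
    idComul k (A ⊗[k] B) (middleFlip k A B (S ⊗ₜ[k] T)) =
      flip3 (idComul k A S ⊗ₜ[k] idComul k B T) := by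
  have : (idComul k (A ⊗[k] B)).comp (middleFlip k A B) =
      flip3.comp (Algebra.TensorProduct.map (idComul k A) (idComul k B)) :=
    algHom_ext4 fun a a' b b' ↦ by
      rfl
  exact DFunLike.congr_fun this (S ⊗ₜ[k] T)

lemma assoc_flip (S : A ⊗[k] A) (T : B ⊗[k] B) (a : A) (b : B) :
    Algebra.TensorProduct.assoc k k k (A ⊗[k] B) (A ⊗[k] B) (A ⊗[k] B)
        (middleFlip k A B (S ⊗ₜ[k] T) ⊗ₜ[k] (a ⊗ₜ[k] b)) =
      flip3 (Algebra.TensorProduct.assoc k k k A A A (S ⊗ₜ[k] a) ⊗ₜ[k]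
        Algebra.TensorProduct.assoc k k k B B B (T ⊗ₜ[k] b)) := by
  induction S with
  | zero => simp
  | tmul x y =>
    induction T with
    | zero => simp
    | tmul z w => simp [flip3, middleFlip]
    | add z w hz hw => simp only [TensorProduct.add_tmul, TensorProduct.tmul_add, map_add, hz, hw]
  | add x y hx hy => simp only [TensorProduct.add_tmul, map_add, hx, hy]

lemma comulId_flip (S : A ⊗[k] A) (T : B ⊗[k] B) :
    comulId k (A ⊗[k] B) (middleFlip k A B (S ⊗ₜ[k] T)) =
      flip3 (comulId k A S ⊗ₜ[k] comulId k B T) := by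
  have : (comulId k (A ⊗[k] B)).comp (middleFlip k A B) =
      flip3.comp (Algebra.TensorProduct.map (comulId k A) (comulId k B)) :=
    algHom_ext4 fun a a' b b' ↦ assoc_flip _ _ _ _
  exact DFunLike.congr_fun this (S ⊗ₜ[k] T)

lemma op_flip (S : A ⊗[k] A) (T : B ⊗[k] B) :
    op k (A ⊗[k] B) (middleFlip k A B (S ⊗ₜ[k] T)) =
      middleFlip k A B (op k A S ⊗ₜ[k] op k B T) := by
  have : (op k (A ⊗[k] B)).comp (middleFlip k A B) =
      (middleFlip k A B).comp (Algebra.TensorProduct.map (op k A) (op k B)) :=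
    algHom_ext4 fun a a' b b' ↦ by simp [op, middleFlip]
  exact DFunLike.congr_fun this (S ⊗ₜ[k] T)

/-- The invertible element `(Id ⊗ τ ⊗ Id)(S ⊗ T)` of `(A ⊗ B) ⊗ (A ⊗ B)`. -/
def flipUnit (S : (A ⊗[k] A)ˣ) (T : (B ⊗[k] B)ˣ) : ((A ⊗[k] B) ⊗[k] (A ⊗[k] B))ˣ where
  val := middleFlip k A B (S.val ⊗ₜ[k] T.val)
  inv := middleFlip k A B (S⁻¹.val ⊗ₜ[k] T⁻¹.val)
  val_inv := by rw [← map_mul]; simp [← Algebra.TensorProduct.one_def]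
  inv_val := by rw [← map_mul]; simp [← Algebra.TensorProduct.one_def]

lemma isTriangularStructure_flipUnit {S : (A ⊗[k] A)ˣ} {T : (B ⊗[k] B)ˣ}
    (hS : IsTriangularStructure k S) (hT : IsTriangularStructure k T) :
    IsTriangularStructure k (flipUnit S T) where
  quasi_cocomm x := by
    change _ = middleFlip k A B (S.val ⊗ₜ[k] T.val) * _ *
      middleFlip k A B (S⁻¹.val ⊗ₜ[k] T⁻¹.val)
    induction x with
    | zero => simp only [map_zero, mul_zero, zero_mul]
    | tmul a b =>
      rw [comulAlgHom_tmul, op_flip, hS.quasi_cocomm, hT.quasi_cocomm, ← map_mul, ← map_mul,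
        Algebra.TensorProduct.tmul_mul_tmul, Algebra.TensorProduct.tmul_mul_tmul]
    | add x y hx hy => simp only [map_add, mul_add, add_mul, hx, hy]
  hexagon_right := by
    change idComul k _ (middleFlip k A B (S.val ⊗ₜ[k] T.val)) =
      leg13 k _ (middleFlip k A B (S.val ⊗ₜ[k] T.val)) *
        leg12 k _ (middleFlip k A B (S.val ⊗ₜ[k] T.val))
    rw [idComul_flip, leg13_flip, leg12_flip, hS.hexagon_right, hT.hexagon_right, ← map_mul,
      Algebra.TensorProduct.tmul_mul_tmul]
  hexagon_left := by
    change comulId k _ (middleFlip k A B (S.val ⊗ₜ[k] T.val)) =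
      leg13 k _ (middleFlip k A B (S.val ⊗ₜ[k] T.val)) *
        leg23 k _ (middleFlip k A B (S.val ⊗ₜ[k] T.val))
    rw [comulId_flip, leg13_flip, leg23_flip, hS.hexagon_left, hT.hexagon_left, ← map_mul,
      Algebra.TensorProduct.tmul_mul_tmul]
  inv_eq_op := by
    change middleFlip k A B (S⁻¹.val ⊗ₜ[k] T⁻¹.val) =
      op k _ (middleFlip k A B (S.val ⊗ₜ[k] T.val))
    rw [op_flip, hS.inv_eq_op, hT.inv_eq_op]

end Tensor

/-- The triangular bialgebra `(H₁ ⊗ H₂, (Id ⊗ τ ⊗ Id)(R₁ ⊗ R₂))`. -/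
def tensorObj (X Y : TwTr k) : TwTr k where
  carrier := X ⊗[k] Y
  R := flipUnit X.R Y.R
  isTriangular := isTriangularStructure_flipUnit X.isTriangular Y.isTriangular

section Projections

variable (A B : Type u) [Ring A] [Ring B] [Bialgebra k A] [Bialgebra k B]

lemma idCounit_flip (S : A ⊗[k] A) (T : B ⊗[k] B) :
    Algebra.TensorProduct.map (idCounit k A B) (idCounit k A B) (middleFlip k A B (S ⊗ₜ[k] T)) =
      Bialgebra.counitAlgHom k B (idCounit k B B T) • S := by
  induction S with
  | zero => simp
  | tmul x y =>
    induction T with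
    | zero => simp
    | tmul z w =>
      simp [idCounit, middleFlip, TensorProduct.smul_tmul, TensorProduct.tmul_smul, smul_smul]
    | add z w hz hw => simp only [TensorProduct.tmul_add, map_add, add_smul, hz, hw]
  | add x y hx hy => simp only [TensorProduct.add_tmul, map_add, smul_add, hx, hy]

lemma counitId_flip (S : A ⊗[k] A) (T : B ⊗[k] B) :
    Algebra.TensorProduct.map (counitId k A B) (counitId k A B) (middleFlip k A B (S ⊗ₜ[k] T)) =
      Bialgebra.counitAlgHom k A (idCounit k A A S) • T := by
  induction S with
  | zero => simp
  | tmul x y =>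
    induction T with
    | zero => simp
    | tmul z w =>
      simp [idCounit, counitId, middleFlip, TensorProduct.smul_tmul, TensorProduct.tmul_smul,
        smul_smul]
    | add z w hz hw => simp only [TensorProduct.tmul_add, map_add, smul_add, hz, hw]
  | add x y hx hy => simp only [TensorProduct.add_tmul, map_add, add_smul, hx, hy]

variable {A} in
lemma idCounit_comul (a : A) : idCounit k A A (Bialgebra.comulAlgHom k A a) = a := by
  have h := Coalgebra.lTensor_counit_comul (R := k) a
  have h2 : ∀ T : A ⊗[k] A, idCounit k A A T =
      Algebra.TensorProduct.rid k k A (Coalgebra.counit.lTensor A T) := by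
    intro T
    induction T with
    | zero => simp
    | tmul x y => simp [idCounit]
    | add x y hx hy => simp only [map_add, hx, hy]
  rw [h2, Bialgebra.comulAlgHom_apply, h]
  simp

lemma comul_idCounit (x : A ⊗[k] B) :
    Bialgebra.comulAlgHom k A (idCounit k A B x) =
      Algebra.TensorProduct.map (idCounit k A B) (idCounit k A B)
        (Bialgebra.comulAlgHom k (A ⊗[k] B) x) := by
  induction x with
  | zero => simp only [map_zero]
  | tmul a b =>
    rw [comulAlgHom_tmul, idCounit_flip, idCounit_comul]
    simp [idCounit]
  | add x y hx hy => simp only [map_add, hx, hy]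

lemma comul_counitId (x : A ⊗[k] B) :
    Bialgebra.comulAlgHom k B (counitId k A B x) =
      Algebra.TensorProduct.map (counitId k A B) (counitId k A B)
        (Bialgebra.comulAlgHom k (A ⊗[k] B) x) := by
  induction x with
  | zero => simp only [map_zero]
  | tmul a b =>
    rw [comulAlgHom_tmul, counitId_flip, idCounit_comul]
    simp [counitId]
  | add x y hx hy => simp only [map_add, hx, hy]

lemma counit_idCounit (x : A ⊗[k] B) :
    Bialgebra.counitAlgHom k A (idCounit k A B x) = Bialgebra.counitAlgHom k (A ⊗[k] B) x := by
  induction x with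
  | zero => simp only [map_zero]
  | tmul a b => simp [idCounit]
  | add x y hx hy => simp only [map_add, hx, hy]

lemma counit_counitId (x : A ⊗[k] B) :
    Bialgebra.counitAlgHom k B (counitId k A B x) = Bialgebra.counitAlgHom k (A ⊗[k] B) x := by
  induction x with
  | zero => simp only [map_zero]
  | tmul a b => simp [counitId, mul_comm]
  | add x y hx hy => simp only [map_add, hx, hy]

variable {A} in
/-- A triangular structure satisfies `(Id ⊗ ε)(R) = 1`. -/
lemma IsTriangularStructure.idCounit_eq {S : (A ⊗[k] A)ˣ} (hS : IsTriangularStructure k S) :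
    idCounit k A A S.val = 1 := by
  have key : ∀ T : A ⊗[k] A,
      Algebra.TensorProduct.map (AlgHom.id k A) (idCounit k A A) (idComul k A T) = T ∧
      Algebra.TensorProduct.map (AlgHom.id k A) (idCounit k A A) (leg12 k A T) = T ∧
      Algebra.TensorProduct.map (AlgHom.id k A) (idCounit k A A) (leg13 k A T) =
        (idCounit k A A T) ⊗ₜ[k] (1 : A) := by
    intro T
    induction T with
    | zero => simp
    | tmul x y =>
      refine ⟨?_, ?_, ?_⟩
      · have := idCounit_comul (k := k) y
        simp only [Bialgebra.comulAlgHom_apply] at this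
        simp [idComul, this]
      · simp [leg12, idCounit]
      · simp [leg13, idCounit, TensorProduct.smul_tmul]
    | add x y hx hy =>
      exact ⟨by rw [map_add, map_add, hx.1, hy.1], by rw [map_add, map_add, hx.2.1, hy.2.1],
        by rw [map_add, map_add, hx.2.2, hy.2.2, map_add, TensorProduct.add_tmul]⟩
  have h := congrArg (Algebra.TensorProduct.map (AlgHom.id k A) (idCounit k A A)) hS.hexagon_right
  rw [map_mul, (key _).1, (key _).2.1, (key _).2.2] at h
  have h1 : (idCounit k A A S.val) ⊗ₜ[k] (1 : A) = 1 := by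
    have := congrArg (· * S⁻¹.val) h
    simpa [mul_assoc] using this.symm
  have h2 := congrArg (idCounit k A A) h1
  simpa [idCounit] using h2

end Projections

/-- The projection `(Id ⊗ ε, 1 ⊗ 1) : (H₁, R₁) ⊗ (H₂, R₂) → (H₁, R₁)`. -/
def fst (X Y : TwTr k) : tensorObj X Y ⟶ X where
  f := idCounit k X Y
  F := 1
  isTwist := isTwist_one k X
  counit_comp x := counit_idCounit X Y x
  comul_comp x := by
    rw [inv_one, Units.val_one, one_mul, mul_one]
    exact comul_idCounit X Y x
  map_R := by
    rw [inv_one, Units.val_one, map_one, one_mul, mul_one]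
    refine (idCounit_flip X Y X.R.val Y.R.val).trans ?_
    rw [Y.isTriangular.idCounit_eq, map_one, one_smul]

/-- The projection `(ε ⊗ Id, 1 ⊗ 1) : (H₁, R₁) ⊗ (H₂, R₂) → (H₂, R₂)`. -/
def snd (X Y : TwTr k) : tensorObj X Y ⟶ Y where
  f := counitId k X Y
  F := 1
  isTwist := isTwist_one k Y
  counit_comp x := counit_counitId X Y x
  comul_comp x := by
    rw [inv_one, Units.val_one, one_mul, mul_one]
    exact comul_counitId X Y x
  map_R := by
    rw [inv_one, Units.val_one, map_one, one_mul, mul_one]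
    refine (counitId_flip X Y X.R.val Y.R.val).trans ?_
    rw [X.isTriangular.idCounit_eq, map_one, one_smul]

/-! ### Finite products in a 2-category -/

section Products

variable {C : Type*} [Bicategory C]

/-- `T` is a terminal object: each functor from `C(X, T)` to the terminal category is an
equivalence of categories. -/
def IsTerminalObject (T : C) : Prop :=
  ∀ X : C, (Functor.star.{0} (X ⟶ T)).IsEquivalence

/-- `P` with projections `p`, `q` is a product of `A` and `B`: each functor
`C(X, P) → C(X, A) × C(X, B)` given by composition with `p` and `q` is an equivalence. -/
def IsBinaryProduct {P A B : C} (p : P ⟶ A) (q : P ⟶ B) : Prop :=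
  ∀ X : C, ((Bicategory.postcomp X p).prod' (Bicategory.postcomp X q)).IsEquivalence

/-- `P` with projections `π i` is a product of the family `A`: each functor
`C(X, P) → ∏ i, C(X, A i)` given by composition with the `π i` is an equivalence. -/
def IsProduct {ι : Type*} {A : ι → C} {P : C} (π : ∀ i, P ⟶ A i) : Prop :=
  ∀ X : C, (Functor.pi' fun i ↦ Bicategory.postcomp X (π i)).IsEquivalence

/-- Every finite family of objects has a product. -/
def HasFiniteProducts (C : Type*) [Bicategory C] : Prop :=
  ∀ (ι : Type w) [Finite ι] (A : ι → C), ∃ (P : C) (π : ∀ i, P ⟶ A i), IsProduct π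

end Products

end TwistedTriangular

end

/-! The binary product rests on two facts about legs 2 and 3 of a fourfold tensor power.

Existence of pairings. The comultiplication `Δ : H → H ⊗ H` is in general not a bialgebra map,
because `Δ` need not be cocommutative. It is nevertheless a twisted morphism once `H ⊗ H` is twisted
by `R` placed on the two middle legs (`diag`). Quasi-cocommutativity gives compatibility with
comultiplications (`diagTwist_comul`). The two hexagons give the cocycle identity
(`isTwist_diagTwist`) and, with `R⁻¹ = R^op`, compatibility with the R-matrices (`comulComul_R`).
Hence `(f ⊗ g) ∘ Δ` underlies a 1-cell `pair p q`. Its components are `p` and `q` on the nose, since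
the counit kills either leg of `R`; this gives essential surjectivity.

Every 1-cell is a pairing up to isomorphism. Let `p = (f, F)` map into `Y ⊗ Z` and put `u = (Id ⊗ ε
⊗ ε ⊗ Id)(F)`, a unit. The element `W = (F ⊗ F)(Δ ⊗ Δ)(F)` can be rewritten as `F₂₃` times something
in the image of `Id ⊗ Δ ⊗ Id` (`IsTwist.cocycle4`), so flipping its middle legs gives `τ₂₃(W) R₂₃ =
(F^op R F⁻¹)₂₃ W`. Applying counits to this identity over `Y ⊗ Z` yields exactly the statement that
`u` is a 2-cell from `p` to the pairing of its components (`toPair`). Every 2-cell `a : p ⇒ q` then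
satisfies `u_q a = (a₁ ⊗ a₂) u_p`, where `a₁`, `a₂` are its components. So `a` is determined by its
components, and any two components are realised by `u_q⁻¹ (a₁ ⊗ a₂) u_p`: the comparison functor is
fully faithful.

Over `k` itself every twist is trivial and the counit conditions leave one 1-cell and one 2-cell, so
`k` is terminal. Terminal object and binary products give all finite products by induction on the
index type. -/

noncomputable section

namespace TwistedTriangular

variable {k : Type u} [Field k]

/-! ### Twists and the R-matrix on four tensor legs -/

section FourLegs

variable {A : Type u} [Ring A] [Bialgebra k A]

/-- Two algebra maps out of `A ⊗ B` agree as soon as they agree on pure tensors. -/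
lemma algHom_ext2 {A B C : Type*} [Semiring A] [Semiring B] [Semiring C] [Algebra k A] [Algebra k B]
    [Algebra k C] {φ ψ : A ⊗[k] B →ₐ[k] C}
    (h : ∀ (a : A) (b : B), φ (a ⊗ₜ[k] b) = ψ (a ⊗ₜ[k] b)) (T : A ⊗[k] B) : φ T = ψ T := by
  have : φ = ψ := AlgHom.toLinearMap_injective (TensorProduct.ext' h)
  rw [this]

/-- The images of two algebra maps out of tensor products commute as soon as this holds for the
images of pure tensors. -/
lemma algHom_commute {A B A' B' C : Type*} [Semiring A] [Semiring B] [Semiring A'] [Semiring B']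
    [Semiring C] [Algebra k A] [Algebra k B] [Algebra k A'] [Algebra k B'] [Algebra k C]
    {φ : A ⊗[k] B →ₐ[k] C} {ψ : A' ⊗[k] B' →ₐ[k] C}
    (h : ∀ a b a' b', Commute (φ (a ⊗ₜ[k] b)) (ψ (a' ⊗ₜ[k] b'))) (S : A ⊗[k] B)
    (T : A' ⊗[k] B') : φ S * ψ T = ψ T * φ S := by
  change Commute _ _
  induction S with
  | zero => simp
  | add x y hx hy => rw [map_add]; exact hx.add_left hy
  | tmul a b =>
    induction T with
    | zero => simp
    | add x y hx hy => rw [map_add]; exact hx.add_right hy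
    | tmul c d => exact h a b c d

variable (k A) in
/-- The map `a ⊗ b ↦ (1 ⊗ a) ⊗ (b ⊗ 1)`. -/
def mid (B : Type u) [Ring B] [Bialgebra k B] : A ⊗[k] B →ₐ[k] (A ⊗[k] A) ⊗[k] (B ⊗[k] B) :=
  Algebra.TensorProduct.map Algebra.TensorProduct.includeRight Algebra.TensorProduct.includeLeft

variable (k A) in
/-- The map `a ⊗ (b ⊗ (c ⊗ d)) ↦ (a ⊗ b) ⊗ (c ⊗ d)`. -/
def assocInv : A ⊗[k] (A ⊗[k] (A ⊗[k] A)) →ₐ[k] (A ⊗[k] A) ⊗[k] (A ⊗[k] A) :=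
  (Algebra.TensorProduct.assoc k k k A A (A ⊗[k] A)).symm.toAlgHom

variable (k A) in
/-- The map `Id ⊗ Id ⊗ Δ`. -/
def idIdComul : A ⊗[k] (A ⊗[k] A) →ₐ[k] (A ⊗[k] A) ⊗[k] (A ⊗[k] A) :=
  (assocInv k A).comp (Algebra.TensorProduct.map (AlgHom.id k A) (idComul k A))

variable (k A) in
/-- The map `Id ⊗ Δ ⊗ Id`. -/
def idComulId : A ⊗[k] (A ⊗[k] A) →ₐ[k] (A ⊗[k] A) ⊗[k] (A ⊗[k] A) :=
  (assocInv k A).comp (Algebra.TensorProduct.map (AlgHom.id k A) (comulId k A))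

variable (k A) in
/-- The map `Δ ⊗ Δ`. -/
abbrev comulComul : A ⊗[k] A →ₐ[k] (A ⊗[k] A) ⊗[k] (A ⊗[k] A) :=
  Algebra.TensorProduct.map (Bialgebra.comulAlgHom k A) (Bialgebra.comulAlgHom k A)

lemma idIdComul_leg12 (T : A ⊗[k] A) : idIdComul k A (leg12 k A T) = T ⊗ₜ[k] 1 := by
  refine algHom_ext2 (φ := (idIdComul k A).comp (leg12 k A))
    (ψ := Algebra.TensorProduct.includeLeft) (fun a b ↦ ?_) T
  simp [idIdComul, leg12, idComul, assocInv, Algebra.TensorProduct.one_def]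

lemma assocInv_comulId (T : A ⊗[k] A) (b : A) :
    assocInv k A (Algebra.TensorProduct.map (AlgHom.id k A) (Algebra.TensorProduct.map
      (AlgHom.id k A) (Bialgebra.comulAlgHom k A))
      (Algebra.TensorProduct.assoc k k k A A A (T ⊗ₜ[k] b))) =
        T ⊗ₜ[k] Bialgebra.comulAlgHom k A b := by
  induction T with
  | zero => simp
  | tmul x y => simp [assocInv]
  | add x y hx hy => simp only [TensorProduct.add_tmul, map_add, hx, hy]

lemma idIdComul_comulId (T : A ⊗[k] A) : idIdComul k A (comulId k A T) = comulComul k A T :=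
  algHom_ext2 (φ := (idIdComul k A).comp (comulId k A)) (ψ := comulComul k A)
    (fun a b ↦ assocInv_comulId (Bialgebra.comulAlgHom k A a) b) T

lemma idIdComul_leg23 (T : A ⊗[k] A) :
    idIdComul k A (leg23 k A T) = assocInv k A (1 ⊗ₜ[k] idComul k A T) := by
  simp [idIdComul, leg23]

lemma idComulId_leg23 (T : A ⊗[k] A) :
    idComulId k A (leg23 k A T) = assocInv k A (1 ⊗ₜ[k] comulId k A T) := by
  simp [idComulId, leg23]

lemma idComul_comul (x : A) :
    idComul k A (Bialgebra.comulAlgHom k A x) = comulId k A (Bialgebra.comulAlgHom k A x) :=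
  (Coalgebra.coassoc_apply (R := k) x).symm

/-- Coassociativity in the second leg. It moves `Δ` from the last leg to the middle pair, the only
place where quasi-cocommutativity can be applied to a middle flip. -/
lemma idIdComul_idComul (T : A ⊗[k] A) :
    idIdComul k A (idComul k A T) = idComulId k A (idComul k A T) :=
  algHom_ext2 (φ := (idIdComul k A).comp (idComul k A))
    (ψ := (idComulId k A).comp (idComul k A))
    (fun a b ↦ congrArg (fun t ↦ assocInv k A (a ⊗ₜ[k] t)) (idComul_comul b)) T

lemma assocInv_leg12 (T : A ⊗[k] A) : assocInv k A (1 ⊗ₜ[k] leg12 k A T) = mid k A A T :=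
  algHom_ext2 (φ := ((assocInv k A).comp Algebra.TensorProduct.includeRight).comp (leg12 k A))
    (ψ := mid k A A) (fun a b ↦ by simp [assocInv, leg12, mid]) T

lemma assocInv_leg23 (T : A ⊗[k] A) : assocInv k A (1 ⊗ₜ[k] leg23 k A T) = 1 ⊗ₜ[k] T := by
  simp [assocInv, leg23, Algebra.TensorProduct.one_def]

/-- The cocycle identity on four tensor factors. -/
lemma IsTwist.cocycle4 {F : (A ⊗[k] A)ˣ} (hF : IsTwist k F) :
    (F.val ⊗ₜ[k] F.val) * comulComul k A F.val =
      mid k A A F.val * idComulId k A (leg23 k A F.val * idComul k A F.val) := by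
  -- The cocycle identity is used twice: here after applying `Id ⊗ Id ⊗ Δ`, and in `h3` on legs 2,
  -- 3, 4. The second use trades `F₃₄ (Id ⊗ Id ⊗ Δ)(F₂₃)` for `F₂₃ (Id ⊗ Δ ⊗ Id)(F₂₃)`.
  have h1 := congrArg (idIdComul k A) hF.cocycle
  rw [map_mul, map_mul, idIdComul_leg12, idIdComul_comulId, idIdComul_leg23,
    idIdComul_idComul] at h1
  have h2 : F.val ⊗ₜ[k] F.val = ((1 : A ⊗[k] A) ⊗ₜ[k] F.val) * (F.val ⊗ₜ[k] (1 : A ⊗[k] A)) := by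
    simp
  have h3 := congrArg (fun t ↦ assocInv k A (1 ⊗ₜ[k] t)) hF.cocycle
  have h4 : ∀ s t : A ⊗[k] (A ⊗[k] A), assocInv k A (1 ⊗ₜ[k] (s * t)) =
      assocInv k A (1 ⊗ₜ[k] s) * assocInv k A (1 ⊗ₜ[k] t) := fun s t ↦ by
    rw [← map_mul, Algebra.TensorProduct.tmul_mul_tmul, one_mul]
  simp only [h4, assocInv_leg12, assocInv_leg23] at h3
  rw [h2, mul_assoc, h1, ← mul_assoc, ← h3, map_mul, idComulId_leg23, mul_assoc]

lemma middleFlip_mid (T : A ⊗[k] A) :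
    middleFlip k A A (mid k A A T) = mid k A A (op k A T) :=
  algHom_ext2 (φ := (middleFlip k A A).comp (mid k A A)) (ψ := (mid k A A).comp (op k A))
    (fun a b ↦ by simp [middleFlip, mid, op]) T

lemma middleFlip_middleFlip (T : (A ⊗[k] A) ⊗[k] (A ⊗[k] A)) :
    middleFlip k A A (middleFlip k A A T) = T :=
  (Algebra.TensorProduct.tensorTensorTensorComm k k k k A A A A).symm_apply_apply T

/-- `Δ^op = R Δ R⁻¹` applied to the two middle tensor factors. -/
lemma IsTriangularStructure.middleFlip_idComulId {R : (A ⊗[k] A)ˣ}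
    (hR : IsTriangularStructure k R) (Y : A ⊗[k] (A ⊗[k] A)) :
    middleFlip k A A (idComulId k A Y) * mid k A A R.val =
      mid k A A R.val * idComulId k A Y := by
  -- A pure tensor is sent to `Δ(b)` on the middle legs times an element of the outer legs. The
  -- outer part is fixed by the flip and commutes with the middle legs, so only `Δ^op(b) R = R Δ(b)`
  -- is left.
  have key : ∀ (a b : A) (T : A ⊗[k] A),
      assocInv k A (a ⊗ₜ[k] Algebra.TensorProduct.assoc k k k A A A (T ⊗ₜ[k] b)) =
        mid k A A T * ((a ⊗ₜ[k] 1) ⊗ₜ[k] (1 ⊗ₜ[k] b)) := fun a b T ↦ by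
    induction T with
    | zero => simp
    | tmul x y => simp [assocInv, mid]
    | add x y hx hy =>
      simp only [TensorProduct.add_tmul, TensorProduct.tmul_add, map_add, hx, hy, add_mul]
  have comm : ∀ (a b : A) (T : A ⊗[k] A),
      ((a ⊗ₜ[k] 1) ⊗ₜ[k] (1 ⊗ₜ[k] b)) * mid k A A T =
        mid k A A T * ((a ⊗ₜ[k] 1) ⊗ₜ[k] (1 ⊗ₜ[k] b)) := fun a b T ↦ by
    induction T with
    | zero => simp
    | tmul x y => simp [mid]
    | add x y hx hy => simp only [map_add, hx, hy, add_mul, mul_add]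
  induction Y with
  | zero => simp
  | add x y hx hy => simp only [map_add, hx, hy, add_mul, mul_add]
  | tmul a T =>
    induction T with
    | zero => simp
    | add x y hx hy => simp only [TensorProduct.tmul_add, map_add, hx, hy, add_mul, mul_add]
    | tmul b c =>
      have h1 : idComulId k A (a ⊗ₜ[k] (b ⊗ₜ[k] c)) = mid k A A (Bialgebra.comulAlgHom k A b) *
          ((a ⊗ₜ[k] 1) ⊗ₜ[k] (1 ⊗ₜ[k] c)) := key a c (Bialgebra.comulAlgHom k A b)
      have h2 : middleFlip k A A ((a ⊗ₜ[k] 1) ⊗ₜ[k] (1 ⊗ₜ[k] c)) =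
          (a ⊗ₜ[k] 1) ⊗ₜ[k] (1 ⊗ₜ[k] c) := by simp [middleFlip]
      have h3 : middleFlip k A A (mid k A A (Bialgebra.comulAlgHom k A b)) =
          mid k A A (op k A (Bialgebra.comulAlgHom k A b)) := middleFlip_mid _
      rw [h1, map_mul, h2, h3, mul_assoc, comm, ← mul_assoc, ← mul_assoc, ← map_mul, ← map_mul,
        hR.quasi_cocomm, mul_assoc, Units.inv_mul, mul_one]

/-- The behaviour of the four-fold twist under the flip of the two middle tensor factors. -/
lemma IsTwist.middleFlip_cocycle4 {F R : (A ⊗[k] A)ˣ} (hF : IsTwist k F)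
    (hR : IsTriangularStructure k R) :
    middleFlip k A A ((F.val ⊗ₜ[k] F.val) * comulComul k A F.val) * mid k A A R.val =
      mid k A A (op k A F.val * R.val * F⁻¹.val) *
        ((F.val ⊗ₜ[k] F.val) * comulComul k A F.val) := by
  have h3 : middleFlip k A A (mid k A A F.val) = mid k A A (op k A F.val) := middleFlip_mid _
  rw [hF.cocycle4, map_mul (middleFlip k A A), mul_assoc, hR.middleFlip_idComulId, h3,
    ← mul_assoc, ← mul_assoc, ← map_mul, ← map_mul, mul_assoc (_ * _), Units.inv_mul, mul_one]

end FourLegs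

/-! ### The comultiplication as a twisted morphism -/

section Diagonal

variable {A : Type u} [Ring A] [Bialgebra k A]

/-- Transported from the right-hand normalisation through `R⁻¹ = R^op`: the flip exchanges the two
counit maps, so `R⁻¹` is normalised on the left, and therefore so is `R`. -/
lemma IsTriangularStructure.counitId_eq {R : (A ⊗[k] A)ˣ} (hR : IsTriangularStructure k R) :
    counitId k A A R.val = 1 := by
  have h : ∀ T : A ⊗[k] A, counitId k A A (op k A T) = idCounit k A A T :=
    algHom_ext2 (φ := (counitId k A A).comp (op k A)) (ψ := idCounit k A A)
      (fun a b ↦ by simp [counitId, idCounit, op])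
  have h1 : counitId k A A R⁻¹.val = 1 := by rw [hR.inv_eq_op, h, hR.idCounit_eq]
  have h2 : counitId k A A R.val * counitId k A A R⁻¹.val = 1 := by
    rw [← map_mul, Units.mul_inv, map_one]
  rwa [h1, mul_one] at h2

/-- The twist on `A ⊗ A` given by `R`, placed on the second copy of the first factor and the
first copy of the second factor. -/
def diagTwist (R : (A ⊗[k] A)ˣ) : ((A ⊗[k] A) ⊗[k] (A ⊗[k] A))ˣ :=
  Units.map ((middleFlip k A A).comp (mid k A A) : A ⊗[k] A →* _) R

lemma diagTwist_val (R : (A ⊗[k] A)ˣ) :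
    (diagTwist R).val = middleFlip k A A (mid k A A R.val) := rfl

variable (k A) in
/-- The map `c ⊗ d ↦ i(c) ⊗ j(d)`, with the two triples of tensor factors interleaved. -/
def legs {C D : Type u} [Ring C] [Ring D] [Algebra k C] [Algebra k D]
    (i : C →ₐ[k] A ⊗[k] (A ⊗[k] A)) (j : D →ₐ[k] A ⊗[k] (A ⊗[k] A)) : C ⊗[k] D →ₐ[k]
      (A ⊗[k] A) ⊗[k] ((A ⊗[k] A) ⊗[k] (A ⊗[k] A)) :=
  flip3.comp (Algebra.TensorProduct.map i j)

lemma legs_eq_comp {C D C' D' : Type u} [Ring C] [Ring D] [Algebra k C] [Algebra k D]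
    [Ring C'] [Ring D'] [Algebra k C'] [Algebra k D']
    (i : C →ₐ[k] A ⊗[k] (A ⊗[k] A)) (j : D →ₐ[k] A ⊗[k] (A ⊗[k] A))
    (φ : C' →ₐ[k] C) (ψ : D' →ₐ[k] D) (T : C' ⊗[k] D') :
    legs k A i j (Algebra.TensorProduct.map φ ψ T) = legs k A (i.comp φ) (j.comp ψ) T :=
  algHom_ext2 (φ := (legs k A i j).comp (Algebra.TensorProduct.map φ ψ))
    (ψ := legs k A (i.comp φ) (j.comp ψ)) (fun _ _ ↦ rfl) T

lemma leg12_middleFlip (T : (A ⊗[k] A) ⊗[k] (A ⊗[k] A)) :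
    leg12 k (A ⊗[k] A) (middleFlip k A A T) = legs k A (leg12 k A) (leg12 k A) T :=
  algHom_ext2 (φ := (leg12 k (A ⊗[k] A)).comp (middleFlip k A A))
    (ψ := legs k A (leg12 k A) (leg12 k A)) leg12_flip T

lemma leg23_middleFlip (T : (A ⊗[k] A) ⊗[k] (A ⊗[k] A)) :
    leg23 k (A ⊗[k] A) (middleFlip k A A T) = legs k A (leg23 k A) (leg23 k A) T :=
  algHom_ext2 (φ := (leg23 k (A ⊗[k] A)).comp (middleFlip k A A))
    (ψ := legs k A (leg23 k A) (leg23 k A)) leg23_flip T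

lemma comulId_middleFlip (T : (A ⊗[k] A) ⊗[k] (A ⊗[k] A)) :
    comulId k (A ⊗[k] A) (middleFlip k A A T) = legs k A (comulId k A) (comulId k A) T :=
  algHom_ext2 (φ := (comulId k (A ⊗[k] A)).comp (middleFlip k A A))
    (ψ := legs k A (comulId k A) (comulId k A)) comulId_flip T

lemma idComul_middleFlip (T : (A ⊗[k] A) ⊗[k] (A ⊗[k] A)) :
    idComul k (A ⊗[k] A) (middleFlip k A A T) = legs k A (idComul k A) (idComul k A) T :=
  algHom_ext2 (φ := (idComul k (A ⊗[k] A)).comp (middleFlip k A A))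
    (ψ := legs k A (idComul k A) (idComul k A)) idComul_flip T

variable (k A) in
/-- The map `a ↦ a ⊗ 1 ⊗ 1`. -/
def inj1 : A →ₐ[k] A ⊗[k] (A ⊗[k] A) := Algebra.TensorProduct.includeLeft

variable (k A) in
/-- The map `a ↦ 1 ⊗ a ⊗ 1`. -/
def inj2 : A →ₐ[k] A ⊗[k] (A ⊗[k] A) :=
  Algebra.TensorProduct.includeRight.comp Algebra.TensorProduct.includeLeft

variable (k A) in
/-- The map `a ↦ 1 ⊗ 1 ⊗ a`. -/
def inj3 : A →ₐ[k] A ⊗[k] (A ⊗[k] A) :=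
  Algebra.TensorProduct.includeRight.comp Algebra.TensorProduct.includeRight

lemma leg12_diag (T : A ⊗[k] A) : leg12 k (A ⊗[k] A) (middleFlip k A A (mid k A A T)) =
    legs k A (inj2 k A) (inj1 k A) T := by
  rw [leg12_middleFlip, mid, legs_eq_comp]; rfl

lemma leg23_diag (T : A ⊗[k] A) : leg23 k (A ⊗[k] A) (middleFlip k A A (mid k A A T)) =
    legs k A (inj3 k A) (inj2 k A) T := by
  rw [leg23_middleFlip, mid, legs_eq_comp]; rfl

/-- Splitting the first copy of `A ⊗ A` splits only the second leg of `R`, because the other factor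
there is `1`. The identity is thus `(Id ⊗ Δ)(R) = R₁₃ R₁₂` with relabelled legs. -/
lemma comulId_diag {R : (A ⊗[k] A)ˣ} (hR : IsTriangularStructure k R) :
    comulId k (A ⊗[k] A) (middleFlip k A A (mid k A A R.val)) =
      legs k A (inj3 k A) (inj2 k A) R.val * legs k A (inj3 k A) (inj1 k A) R.val := by
  have h : ∀ T : A ⊗[k] A, legs k A (comulId k A) (comulId k A) (mid k A A T) =
      legs k A (inj3 k A) (leg12 k A) (idComul k A T) :=
    algHom_ext2 (φ := (legs k A (comulId k A) (comulId k A)).comp (mid k A A))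
      (ψ := (legs k A (inj3 k A) (leg12 k A)).comp (idComul k A)) fun a b ↦ by
        have h1 : comulId k A (1 ⊗ₜ[k] a) = inj3 k A a := by
          simp [comulId, inj3, Algebra.TensorProduct.one_def]
        have h2 : ∀ T : A ⊗[k] A, Algebra.TensorProduct.assoc k k k A A A (T ⊗ₜ[k] (1 : A)) =
          leg12 k A T := fun T ↦ by
            rw [assoc_leg, ← Algebra.TensorProduct.one_def, map_one, mul_one]
        have h3 : comulId k A (b ⊗ₜ[k] 1) = leg12 k A (Bialgebra.comulAlgHom k A b) := h2 _
        exact congrArg₂ (fun s t ↦ flip3 (s ⊗ₜ[k] t)) h1 h3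
  have h13 : ∀ T : A ⊗[k] A, legs k A (inj3 k A) (leg12 k A) (leg13 k A T) =
      legs k A (inj3 k A) (inj2 k A) T := fun T ↦ by
    rw [leg13, legs_eq_comp]; rfl
  have h12 : ∀ T : A ⊗[k] A, legs k A (inj3 k A) (leg12 k A) (leg12 k A T) =
      legs k A (inj3 k A) (inj1 k A) T := fun T ↦ by
    rw [leg12, legs_eq_comp]; rfl
  rw [comulId_middleFlip, h, hR.hexagon_right, map_mul, h13, h12]

/-- The mirror case: the first leg of `R` is split, so the other hexagon `(Δ ⊗ Id)(R) = R₁₃ R₂₃` is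
used. The map `ψ` performs the relabelling after the reassociation built into `comulId`. -/
lemma idComul_diag {R : (A ⊗[k] A)ˣ} (hR : IsTriangularStructure k R) :
    idComul k (A ⊗[k] A) (middleFlip k A A (mid k A A R.val)) =
      legs k A (inj2 k A) (inj1 k A) R.val * legs k A (inj3 k A) (inj1 k A) R.val := by
  let ψ : A ⊗[k] (A ⊗[k] A) →ₐ[k] _ := (legs k A (leg23 k A) (inj1 k A)).comp
    (Algebra.TensorProduct.assoc k k k A A A).symm.toAlgHom
  have h : ∀ T : A ⊗[k] A, legs k A (idComul k A) (idComul k A) (mid k A A T) =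
      ψ (comulId k A T) :=
    algHom_ext2 (φ := (legs k A (idComul k A) (idComul k A)).comp (mid k A A))
      (ψ := ψ.comp (comulId k A)) fun a b ↦ by
        have h1 : idComul k A (b ⊗ₜ[k] 1) = inj1 k A b := by
          simp [idComul, inj1, Algebra.TensorProduct.one_def]
        have h2 : comulId k A (a ⊗ₜ[k] b) = Algebra.TensorProduct.assoc k k k A A A
          (Bialgebra.comulAlgHom k A a ⊗ₜ[k] b) := rfl
        have h3 : ψ (comulId k A (a ⊗ₜ[k] b)) =
            legs k A (leg23 k A) (inj1 k A) (Bialgebra.comulAlgHom k A a ⊗ₜ[k] b) := by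
          rw [h2]
          exact congrArg (legs k A (leg23 k A) (inj1 k A))
            (AlgEquiv.symm_apply_apply (Algebra.TensorProduct.assoc k k k A A A) _)
        exact (congrArg (fun t ↦ flip3 ((leg23 k A (Bialgebra.comulAlgHom k A a)) ⊗ₜ[k] t))
          h1).trans h3.symm
  have h13 : ∀ T : A ⊗[k] A, ψ (leg13 k A T) = legs k A (inj2 k A) (inj1 k A) T :=
    algHom_ext2 (φ := ψ.comp (leg13 k A)) (ψ := legs k A (inj2 k A) (inj1 k A)) fun a b ↦ rfl
  have h23 : ∀ T : A ⊗[k] A, ψ (leg23 k A T) = legs k A (inj3 k A) (inj1 k A) T :=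
    algHom_ext2 (φ := ψ.comp (leg23 k A)) (ψ := legs k A (inj3 k A) (inj1 k A)) fun a b ↦ rfl
  rw [idComul_middleFlip, h, hR.hexagon_left, map_mul, h13, h23]

/-- The two elements occupy disjoint sets of the six tensor legs. -/
lemma legs_comm (S T : A ⊗[k] A) :
    legs k A (inj2 k A) (inj1 k A) S * legs k A (inj3 k A) (inj2 k A) T =
      legs k A (inj3 k A) (inj2 k A) T * legs k A (inj2 k A) (inj1 k A) S := by
  refine algHom_commute (fun a b c d ↦ ?_) S T
  have h : Commute (inj2 k A a ⊗ₜ[k] inj1 k A b) (inj3 k A c ⊗ₜ[k] inj2 k A d) := by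
    change _ * _ = _ * _
    simp [inj1, inj2, inj3]
  exact h.map (flip3 (k := k) (A := A) (B := A))

/-- By the hexagons both sides of the cocycle identity are products of the same three copies of `R`.
They differ only in the order of the first two, which commute, so the Yang–Baxter equation is not
needed. -/
lemma isTwist_diagTwist {R : (A ⊗[k] A)ˣ} (hR : IsTriangularStructure k R) :
    IsTwist k (diagTwist R) where
  cocycle := by
    rw [diagTwist_val, leg12_diag, leg23_diag, comulId_diag hR, idComul_diag hR, ← mul_assoc,
      ← mul_assoc, legs_comm]
  counit_left := by
    have h : ∀ T : A ⊗[k] A, counitId k (A ⊗[k] A) (A ⊗[k] A) (middleFlip k A A (mid k A A T)) =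
        idCounit k A A T ⊗ₜ[k] 1 :=
      algHom_ext2 (φ := (counitId k (A ⊗[k] A) (A ⊗[k] A)).comp
        ((middleFlip k A A).comp (mid k A A)))
        (ψ := Algebra.TensorProduct.includeLeft.comp (idCounit k A A)) fun a b ↦ by
          simp [counitId, middleFlip, mid, idCounit, TensorProduct.smul_tmul']
    rw [diagTwist_val, h, hR.idCounit_eq, Algebra.TensorProduct.one_def]
  counit_right := by
    have h : ∀ T : A ⊗[k] A, idCounit k (A ⊗[k] A) (A ⊗[k] A) (middleFlip k A A (mid k A A T)) =
        1 ⊗ₜ[k] counitId k A A T :=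
      algHom_ext2 (φ := (idCounit k (A ⊗[k] A) (A ⊗[k] A)).comp
        ((middleFlip k A A).comp (mid k A A)))
        (ψ := Algebra.TensorProduct.includeRight.comp (counitId k A A)) fun a b ↦ by
          simp [counitId, middleFlip, mid, idCounit]
    rw [diagTwist_val, h, hR.counitId_eq, Algebra.TensorProduct.one_def]

/-- The fourfold comultiplication is written with its middle legs produced by a single `Δ`; flipping
them is then conjugation by `R`. -/
lemma comulComul_comul (x : A) : comulComul k A (Bialgebra.comulAlgHom k A x) =
    idComulId k A (idComul k A (Bialgebra.comulAlgHom k A x)) := by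
  rw [← idIdComul_idComul, idComul_comul, idIdComul_comulId]

lemma diagTwist_comul {R : (A ⊗[k] A)ˣ} (hR : IsTriangularStructure k R) (x : A) :
    (diagTwist R).val * Bialgebra.comulAlgHom k (A ⊗[k] A) (Bialgebra.comulAlgHom k A x) =
      comulComul k A (Bialgebra.comulAlgHom k A x) * (diagTwist R).val := by
  have h : Bialgebra.comulAlgHom k (A ⊗[k] A) (Bialgebra.comulAlgHom k A x) =
      middleFlip k A A (comulComul k A (Bialgebra.comulAlgHom k A x)) := rfl
  have h1 := congrArg (middleFlip k A A)
    (hR.middleFlip_idComulId (idComul k A (Bialgebra.comulAlgHom k A x)))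
  rw [map_mul, map_mul, middleFlip_middleFlip] at h1
  rw [h, diagTwist_val, comulComul_comul, h1]

/-- The hexagons expand the left side to `R₁₄ R₁₃ R₂₄ R₂₃`. On the right, the opposite of the twist
is `R₁₄`, the R-matrix of `A ⊗ A` is `R₁₃ R₂₄`, and the inverse of the twist is `R₂₃`. -/
lemma comulComul_R {R : (A ⊗[k] A)ˣ} (hR : IsTriangularStructure k R) :
    comulComul k A R.val =
      op k (A ⊗[k] A) (diagTwist R).val * (flipUnit R R).val * (diagTwist R)⁻¹.val := by
  let ι₁ : A →ₐ[k] A ⊗[k] A := Algebra.TensorProduct.includeLeft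
  let ι₂ : A →ₐ[k] A ⊗[k] A := Algebra.TensorProduct.includeRight
  let κ : A ⊗[k] (A ⊗[k] A) →ₐ[k] (A ⊗[k] A) ⊗[k] (A ⊗[k] A) :=
    Algebra.TensorProduct.map ι₁ (AlgHom.id k _)
  let κ' : A ⊗[k] (A ⊗[k] A) →ₐ[k] (A ⊗[k] A) ⊗[k] (A ⊗[k] A) :=
    Algebra.TensorProduct.map ι₂ (AlgHom.id k _)
  have e1 : ∀ T : A ⊗[k] A, idIdComul k A (leg13 k A T) = κ (idComul k A T) :=
    algHom_ext2 (φ := (idIdComul k A).comp (leg13 k A)) (ψ := κ.comp (idComul k A)) fun a b ↦ by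
      simp [idIdComul, leg13, κ, ι₁, idComul, assocInv]
  have e2 : ∀ T : A ⊗[k] A, idIdComul k A (leg23 k A T) = κ' (idComul k A T) :=
    algHom_ext2 (φ := (idIdComul k A).comp (leg23 k A)) (ψ := κ'.comp (idComul k A)) fun a b ↦ by
      simp [idIdComul, leg23, κ', ι₂, idComul, assocInv]
  have hop : ∀ T : A ⊗[k] A, op k (A ⊗[k] A) (middleFlip k A A (mid k A A T)) =
      κ (leg13 k A T) :=
    algHom_ext2 (φ := (op k (A ⊗[k] A)).comp ((middleFlip k A A).comp (mid k A A)))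
      (ψ := κ.comp (leg13 k A)) fun a b ↦ by simp [op, middleFlip, mid, κ, ι₁, leg13]
  -- The twist is `R^op` on legs 2 and 3, so its inverse is `R₂₃` because `R⁻¹ = R^op`. This is
  -- where triangularity, rather than quasi-triangularity, enters.
  have hinv : (diagTwist R)⁻¹.val = κ' (leg12 k A R.val) := by
    have h : ∀ T : A ⊗[k] A, middleFlip k A A (mid k A A (op k A T)) = κ' (leg12 k A T) :=
      algHom_ext2 (φ := ((middleFlip k A A).comp (mid k A A)).comp (op k A))
        (ψ := κ'.comp (leg12 k A)) fun a b ↦ by simp [op, middleFlip, mid, κ', ι₂, leg12]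
    rw [← h, ← hR.inv_eq_op]
    rfl
  have hR2 : (flipUnit R R).val = κ (leg12 k A R.val) * κ' (leg13 k A R.val) := by
    have h1 : ∀ T : A ⊗[k] A, middleFlip k A A (T ⊗ₜ[k] 1) = κ (leg12 k A T) :=
      algHom_ext2 (φ := (middleFlip k A A).comp Algebra.TensorProduct.includeLeft)
        (ψ := κ.comp (leg12 k A)) fun a b ↦ by
          simp [middleFlip, κ, ι₁, leg12, Algebra.TensorProduct.one_def]
    have h2 : ∀ T : A ⊗[k] A, middleFlip k A A (1 ⊗ₜ[k] T) = κ' (leg13 k A T) :=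
      algHom_ext2 (φ := (middleFlip k A A).comp Algebra.TensorProduct.includeRight)
        (ψ := κ'.comp (leg13 k A)) fun a b ↦ by
          simp [middleFlip, κ', ι₂, leg13, Algebra.TensorProduct.one_def]
    rw [← h1, ← h2, ← map_mul, Algebra.TensorProduct.tmul_mul_tmul, one_mul, mul_one]
    rfl
  rw [← idIdComul_comulId, hR.hexagon_left, map_mul, e1, e2, hR.hexagon_right, map_mul, map_mul,
    diagTwist_val, hop, hinv, hR2]
  simp only [mul_assoc]

end Diagonal

/-! ### Tensor products of twisted morphisms -/

section TensorProduct

variable {A B C D : Type u} [Ring A] [Ring B] [Ring C] [Ring D] [Bialgebra k A] [Bialgebra k B]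
  [Bialgebra k C] [Bialgebra k D]

lemma map_middleFlip (f : A →ₐ[k] C) (g : B →ₐ[k] D)
    (T : (A ⊗[k] A) ⊗[k] (B ⊗[k] B)) :
    Algebra.TensorProduct.map (Algebra.TensorProduct.map f g) (Algebra.TensorProduct.map f g)
        (middleFlip k A B T) =
      middleFlip k C D (Algebra.TensorProduct.map (Algebra.TensorProduct.map f f)
        (Algebra.TensorProduct.map g g) T) := by
  have := algHom_ext4 (φ := (Algebra.TensorProduct.map (Algebra.TensorProduct.map f g)
      (Algebra.TensorProduct.map f g)).comp (middleFlip k A B))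
    (ψ := (middleFlip k C D).comp (Algebra.TensorProduct.map (Algebra.TensorProduct.map f f)
        (Algebra.TensorProduct.map g g))) fun a a' b b' ↦ by simp [middleFlip]
  exact DFunLike.congr_fun this T

lemma isTwist_flipUnit {F : (A ⊗[k] A)ˣ} {G : (B ⊗[k] B)ˣ} (hF : IsTwist k F)
    (hG : IsTwist k G) : IsTwist k (flipUnit F G) where
  cocycle := by
    change leg12 k _ (middleFlip k A B (F.val ⊗ₜ[k] G.val)) *
        comulId k _ (middleFlip k A B (F.val ⊗ₜ[k] G.val)) =
      leg23 k _ (middleFlip k A B (F.val ⊗ₜ[k] G.val)) *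
        idComul k _ (middleFlip k A B (F.val ⊗ₜ[k] G.val))
    rw [leg12_flip, leg23_flip, comulId_flip, idComul_flip, ← map_mul, ← map_mul,
      Algebra.TensorProduct.tmul_mul_tmul, Algebra.TensorProduct.tmul_mul_tmul, hF.cocycle,
      hG.cocycle]
  counit_left := by
    have h := algHom_ext4 (φ := (counitId k (A ⊗[k] B) (A ⊗[k] B)).comp (middleFlip k A B))
      (ψ := Algebra.TensorProduct.map (counitId k A A) (counitId k B B)) fun a a' b b' ↦ by
        simp [counitId, middleFlip, TensorProduct.smul_tmul', TensorProduct.tmul_smul, smul_smul]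
    refine (DFunLike.congr_fun h (F.val ⊗ₜ[k] G.val)).trans ?_
    rw [Algebra.TensorProduct.map_tmul, hF.counit_left, hG.counit_left,
      Algebra.TensorProduct.one_def]
  counit_right := by
    have h := algHom_ext4 (φ := (idCounit k (A ⊗[k] B) (A ⊗[k] B)).comp (middleFlip k A B))
      (ψ := Algebra.TensorProduct.map (idCounit k A A) (idCounit k B B)) fun a a' b b' ↦ by
        simp [idCounit, middleFlip, TensorProduct.smul_tmul', TensorProduct.tmul_smul, smul_smul]
    refine (DFunLike.congr_fun h (F.val ⊗ₜ[k] G.val)).trans ?_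
    rw [Algebra.TensorProduct.map_tmul, hF.counit_right, hG.counit_right,
      Algebra.TensorProduct.one_def]

lemma counit_map (f : A →ₐ[k] C) (g : B →ₐ[k] D)
    (hf : ∀ x, Bialgebra.counitAlgHom k C (f x) = Bialgebra.counitAlgHom k A x)
    (hg : ∀ x, Bialgebra.counitAlgHom k D (g x) = Bialgebra.counitAlgHom k B x) (x : A ⊗[k] B) :
    Bialgebra.counitAlgHom k (C ⊗[k] D) (Algebra.TensorProduct.map f g x) =
      Bialgebra.counitAlgHom k (A ⊗[k] B) x := by
  simp only [Bialgebra.counitAlgHom_apply] at hf hg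
  exact algHom_ext2 (φ := (Bialgebra.counitAlgHom k (C ⊗[k] D)).comp
    (Algebra.TensorProduct.map f g)) (ψ := Bialgebra.counitAlgHom k (A ⊗[k] B))
    (fun a b ↦ by simp [hf, hg]) x

lemma comul_map (f : A →ₐ[k] C) (g : B →ₐ[k] D) {F : C ⊗[k] C} {G : D ⊗[k] D}
    (hf : ∀ x, F * Bialgebra.comulAlgHom k C (f x) =
      Algebra.TensorProduct.map f f (Bialgebra.comulAlgHom k A x) * F)
    (hg : ∀ x, G * Bialgebra.comulAlgHom k D (g x) =
      Algebra.TensorProduct.map g g (Bialgebra.comulAlgHom k B x) * G) (x : A ⊗[k] B) :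
    middleFlip k C D (F ⊗ₜ[k] G) *
        Bialgebra.comulAlgHom k (C ⊗[k] D) (Algebra.TensorProduct.map f g x) =
      Algebra.TensorProduct.map (Algebra.TensorProduct.map f g) (Algebra.TensorProduct.map f g)
        (Bialgebra.comulAlgHom k (A ⊗[k] B) x) * middleFlip k C D (F ⊗ₜ[k] G) := by
  induction x with
  | zero => simp only [map_zero, mul_zero, zero_mul]
  | add x y hx hy => simp only [map_add, mul_add, add_mul, hx, hy]
  | tmul a b =>
    rw [Algebra.TensorProduct.map_tmul, comulAlgHom_tmul, comulAlgHom_tmul, map_middleFlip,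
      ← map_mul, ← map_mul, Algebra.TensorProduct.map_tmul, Algebra.TensorProduct.tmul_mul_tmul,
      Algebra.TensorProduct.tmul_mul_tmul, hf, hg]

end TensorProduct

/-! ### Pairings of 1-cells and of 2-cells -/

/-- The diagonal 1-cell `X → X ⊗ X`, given by the comultiplication. -/
def diag (X : TwTr k) : TwistedHom X (tensorObj X X) where
  f := Bialgebra.comulAlgHom k X
  F := diagTwist X.R
  isTwist := isTwist_diagTwist X.isTriangular
  counit_comp x := by
    refine (counit_idCounit X X (Bialgebra.comulAlgHom k X x)).symm.trans ?_
    rw [idCounit_comul]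
  comul_comp x := (Units.mul_inv_eq_iff_eq_mul _).2 (diagTwist_comul X.isTriangular x)
  map_R := comulComul_R X.isTriangular

/-- The tensor product of two 1-cells. -/
def tensorHom {X X' Y Y' : TwTr k} (p : TwistedHom X Y) (q : TwistedHom X' Y') :
    TwistedHom (tensorObj X X') (tensorObj Y Y') where
  f := Algebra.TensorProduct.map p.f q.f
  F := flipUnit p.F q.F
  isTwist := isTwist_flipUnit p.isTwist q.isTwist
  counit_comp x := counit_map p.f q.f p.counit_comp q.counit_comp x
  comul_comp x := (Units.mul_inv_eq_iff_eq_mul _).2 (comul_map p.f q.f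
    (fun a ↦ (Units.mul_inv_eq_iff_eq_mul _).1 (p.comul_comp a))
    (fun b ↦ (Units.mul_inv_eq_iff_eq_mul _).1 (q.comul_comp b)) x)
  map_R := by
    refine (map_middleFlip p.f q.f (X.R.val ⊗ₜ[k] X'.R.val)).trans ?_
    refine Eq.trans ?_ (congrArg (fun t ↦ t * middleFlip k Y Y' (Y.R.val ⊗ₜ[k] Y'.R.val) *
      middleFlip k Y Y' (p.F⁻¹.val ⊗ₜ[k] q.F⁻¹.val)) (op_flip p.F.val q.F.val).symm)
    rw [← map_mul, ← map_mul, Algebra.TensorProduct.tmul_mul_tmul,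
      Algebra.TensorProduct.tmul_mul_tmul, Algebra.TensorProduct.map_tmul, p.map_R, q.map_R]

/-- The 1-cell `X → Y ⊗ Z` with components `p` and `q`. -/
def pair {X Y Z : TwTr k} (p : TwistedHom X Y) (q : TwistedHom X Z) :
    TwistedHom X (tensorObj Y Z) :=
  (diag X).comp (tensorHom p q)

/-- The tensor product of two 2-cells. -/
def tensorGauge {X X' Y Y' : TwTr k} {p q : TwistedHom X Y} {p' q' : TwistedHom X' Y'}
    (a : Gauge p q) (b : Gauge p' q') : Gauge (tensorHom p p') (tensorHom q q') where
  a := a.a ⊗ₜ[k] b.a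
  counit_a := by
    have h1 := a.counit_a
    have h2 := b.counit_a
    simp only [Bialgebra.counitAlgHom_apply] at h1 h2
    change Bialgebra.counitAlgHom k (Y ⊗[k] Y') (a.a ⊗ₜ[k] b.a) = 1
    simp [h1, h2]
  gauge_twist := by
    change middleFlip k Y Y' ((a.a ⊗ₜ[k] a.a) ⊗ₜ[k] (b.a ⊗ₜ[k] b.a)) *
      middleFlip k Y Y' (p.F.val ⊗ₜ[k] p'.F.val) = middleFlip k Y Y' (q.F.val ⊗ₜ[k] q'.F.val) *
        middleFlip k Y Y' (Bialgebra.comulAlgHom k Y a.a ⊗ₜ[k] Bialgebra.comulAlgHom k Y' b.a)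
    rw [← map_mul, ← map_mul, Algebra.TensorProduct.tmul_mul_tmul,
      Algebra.TensorProduct.tmul_mul_tmul, a.gauge_twist, b.gauge_twist]
  gauge_hom x := by
    change X ⊗[k] X' at x
    change (a.a ⊗ₜ[k] b.a) * Algebra.TensorProduct.map p.f p'.f x =
      Algebra.TensorProduct.map q.f q'.f x * (a.a ⊗ₜ[k] b.a)
    induction x with
    | zero => simp only [map_zero, mul_zero, zero_mul]
    | add x y hx hy => simp only [map_add, mul_add, add_mul, hx, hy]
    | tmul x y =>
      rw [Algebra.TensorProduct.map_tmul, Algebra.TensorProduct.map_tmul,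
        Algebra.TensorProduct.tmul_mul_tmul, Algebra.TensorProduct.tmul_mul_tmul, a.gauge_hom,
        b.gauge_hom]

/-- The 2-cell between pairings induced by 2-cells between the components. -/
def pairGauge {X Y Z : TwTr k} {p q : TwistedHom X Y} {p' q' : TwistedHom X Z}
    (a : Gauge p q) (b : Gauge p' q') : Gauge (pair p p') (pair q q') :=
  Gauge.hcomp (Gauge.id (diag X)) (tensorGauge a b)

lemma pairGauge_a {X Y Z : TwTr k} {p q : TwistedHom X Y} {p' q' : TwistedHom X Z}
    (a : Gauge p q) (b : Gauge p' q') : (pairGauge a b).a = a.a ⊗ₜ[k] b.a := by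
  change (a.a ⊗ₜ[k] b.a) * Algebra.TensorProduct.map p.f p'.f (1 : X ⊗[k] X) = _
  rw [map_one, mul_one]

/-- The inverse of an invertible 2-cell. -/
def Gauge.inv {X Y : TwTr k} {p q : TwistedHom X Y} (a : Gauge p q) (u : Yˣ) (h : u.val = a.a) :
    Gauge q p where
  a := u⁻¹.val
  counit_a := by
    have h1 := congrArg (Bialgebra.counitAlgHom k Y) u.mul_inv
    rwa [map_mul, h, a.counit_a, one_mul, map_one] at h1
  gauge_twist := by
    have h1 := a.gauge_twist
    have h2 := congrArg (Bialgebra.comulAlgHom k Y) u.mul_inv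
    rw [map_mul, map_one] at h2
    rw [← h] at h1
    calc (u⁻¹.val ⊗ₜ[k] u⁻¹.val) * q.F.val
        = (u⁻¹.val ⊗ₜ[k] u⁻¹.val) * (q.F.val * Bialgebra.comulAlgHom k Y u.val) *
            Bialgebra.comulAlgHom k Y u⁻¹.val := by
          rw [mul_assoc, mul_assoc q.F.val, h2, mul_one]
      _ = _ := by
          rw [← h1, ← mul_assoc, Algebra.TensorProduct.tmul_mul_tmul, Units.inv_mul,
            ← Algebra.TensorProduct.one_def, one_mul]
  gauge_hom x := by
    have h1 := a.gauge_hom x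
    rw [← h] at h1
    rw [Units.inv_mul_eq_iff_eq_mul, ← mul_assoc, Units.eq_mul_inv_iff_mul_eq, h1]

/-! ### Projecting a twist on `A ⊗ B` to its components -/

section Components

variable {A B : Type u} [Ring A] [Ring B] [Bialgebra k A] [Bialgebra k B]

variable (k A B) in
/-- The map `(Id ⊗ ε) ⊗ (ε ⊗ Id)`. -/
def outer : (A ⊗[k] B) ⊗[k] (A ⊗[k] B) →ₐ[k] A ⊗[k] B :=
  Algebra.TensorProduct.map (idCounit k A B) (counitId k A B)

lemma outer_middleFlip (S : A ⊗[k] A) (T : B ⊗[k] B) : outer k A B (middleFlip k A B (S ⊗ₜ[k] T)) =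
    idCounit k A A S ⊗ₜ[k] counitId k B B T := by
  have h := algHom_ext4 (φ := (outer k A B).comp (middleFlip k A B))
    (ψ := Algebra.TensorProduct.map (idCounit k A A) (counitId k B B)) fun a a' b b' ↦ by
      simp [outer, idCounit, counitId, middleFlip, TensorProduct.smul_tmul',
        TensorProduct.tmul_smul, smul_smul, mul_comm]
  exact DFunLike.congr_fun h (S ⊗ₜ[k] T)

lemma counitId_comul (a : A) : counitId k A A (Bialgebra.comulAlgHom k A a) = a := by
  have h : ∀ T : A ⊗[k] A, counitId k A A T =
      TensorProduct.lid k A (Coalgebra.counit.rTensor A T) := by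
    intro T
    induction T with
    | zero => simp
    | tmul x y => simp [counitId]
    | add x y hx hy => simp only [map_add, hx, hy]
  rw [h, Bialgebra.comulAlgHom_apply, Coalgebra.rTensor_counit_comul]
  simp

/-- The counit axioms of `A` and `B`, applied on opposite sides: `outer` is a retraction of the
comultiplication of `A ⊗ B`. -/
lemma outer_comul (x : A ⊗[k] B) :
    outer k A B (Bialgebra.comulAlgHom k (A ⊗[k] B) x) = x :=
  algHom_ext2 (φ := (outer k A B).comp (Bialgebra.comulAlgHom k (A ⊗[k] B)))
    (ψ := AlgHom.id k _) (fun a b ↦ by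
      rw [AlgHom.comp_apply, comulAlgHom_tmul, outer_middleFlip, idCounit_comul, counitId_comul,
        AlgHom.id_apply]) x

/-- Both sides apply `ε` to every leg except the first. Hence the normalisation of a twist passes to
its image under `outer`. -/
lemma idCounit_outer (T : (A ⊗[k] B) ⊗[k] (A ⊗[k] B)) :
    idCounit k A B (outer k A B T) = idCounit k A B (idCounit k (A ⊗[k] B) (A ⊗[k] B) T) :=
  algHom_ext2 (φ := (idCounit k A B).comp (outer k A B))
    (ψ := (idCounit k A B).comp (idCounit k (A ⊗[k] B) (A ⊗[k] B))) (fun x y ↦ by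
      have h := counit_counitId A B y
      have h1 : ∀ (C D : Type u) [Ring C] [Ring D] [Bialgebra k C] [Bialgebra k D] (c : C) (d : D),
          idCounit k C D (c ⊗ₜ[k] d) = Bialgebra.counitAlgHom k D d • c := fun C D _ _ _ _ c d ↦ by
        simp [idCounit]
      rw [AlgHom.comp_apply, AlgHom.comp_apply, outer, Algebra.TensorProduct.map_tmul, h1, h1, h,
        map_smul]) T

lemma counitId_outer (T : (A ⊗[k] B) ⊗[k] (A ⊗[k] B)) :
    counitId k A B (outer k A B T) = counitId k A B (counitId k (A ⊗[k] B) (A ⊗[k] B) T) :=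
  algHom_ext2 (φ := (counitId k A B).comp (outer k A B))
    (ψ := (counitId k A B).comp (counitId k (A ⊗[k] B) (A ⊗[k] B))) (fun x y ↦ by
      have h := counit_idCounit A B x
      have h1 : ∀ (C D : Type u) [Ring C] [Ring D] [Bialgebra k C] [Bialgebra k D] (c : C) (d : D),
          counitId k C D (c ⊗ₜ[k] d) = Bialgebra.counitAlgHom k C c • d := fun C D _ _ _ _ c d ↦ by
        simp [counitId]
      rw [AlgHom.comp_apply, AlgHom.comp_apply, outer, Algebra.TensorProduct.map_tmul, h1, h1, h,
        map_smul]) T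

variable (k A B) in
/-- The map `(Id ⊗ ε) ⊗ (Id ⊗ ε) ⊗ (ε ⊗ Id) ⊗ (ε ⊗ Id)`. -/
def outer4 : ((A ⊗[k] B) ⊗[k] (A ⊗[k] B)) ⊗[k] ((A ⊗[k] B) ⊗[k] (A ⊗[k] B)) →ₐ[k]
    (A ⊗[k] A) ⊗[k] (B ⊗[k] B) :=
  Algebra.TensorProduct.map
    (Algebra.TensorProduct.map (idCounit k A B) (idCounit k A B))
    (Algebra.TensorProduct.map (counitId k A B) (counitId k A B))

lemma outer4_mid (T : (A ⊗[k] B) ⊗[k] (A ⊗[k] B)) :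
    outer4 k A B (mid k (A ⊗[k] B) (A ⊗[k] B) T) = mid k A B (outer k A B T) :=
  algHom_ext2 (φ := (outer4 k A B).comp (mid k (A ⊗[k] B) (A ⊗[k] B)))
    (ψ := (mid k A B).comp (outer k A B)) (fun x y ↦ by simp [outer4, mid, outer]) T

lemma outer4_comulComul (T : (A ⊗[k] B) ⊗[k] (A ⊗[k] B)) :
    middleFlip k A B (outer4 k A B (comulComul k (A ⊗[k] B) T)) =
      Bialgebra.comulAlgHom k (A ⊗[k] B) (outer k A B T) :=
  algHom_ext2 (φ := (middleFlip k A B).comp ((outer4 k A B).comp (comulComul k (A ⊗[k] B))))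
    (ψ := (Bialgebra.comulAlgHom k (A ⊗[k] B)).comp (outer k A B)) (fun x y ↦ by
      simp only [AlgHom.comp_apply, comulComul, outer4, outer, Algebra.TensorProduct.map_tmul]
      rw [← comul_idCounit, ← comul_counitId, comulAlgHom_tmul]) T

lemma middleFlip_outer4_middleFlip
    (T : ((A ⊗[k] B) ⊗[k] (A ⊗[k] B)) ⊗[k] ((A ⊗[k] B) ⊗[k] (A ⊗[k] B))) :
    middleFlip k A B (outer4 k A B (middleFlip k (A ⊗[k] B) (A ⊗[k] B) T)) =
      Algebra.TensorProduct.map (outer k A B) (outer k A B) T := by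
  have := algHom_ext4 (φ := (middleFlip k A B).comp
      ((outer4 k A B).comp (middleFlip k (A ⊗[k] B) (A ⊗[k] B))))
    (ψ := Algebra.TensorProduct.map (outer k A B) (outer k A B)) fun a a' b b' ↦ by
      simp [middleFlip, outer4, outer]
  exact DFunLike.congr_fun this T

/-- A twist on `A ⊗ B` is gauge equivalent to one determined by its two components. -/
lemma IsTwist.outer_tmul_outer {F : ((A ⊗[k] B) ⊗[k] (A ⊗[k] B))ˣ} (hF : IsTwist k F)
    {S : (A ⊗[k] A)ˣ} {T : (B ⊗[k] B)ˣ} (hS : IsTriangularStructure k S)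
    (hT : IsTriangularStructure k T) :
    (outer k A B F.val ⊗ₜ[k] outer k A B F.val) * F.val =
      middleFlip k A B (mid k A B (outer k A B
        (op k (A ⊗[k] B) F.val * (flipUnit S T).val * F⁻¹.val))) *
      middleFlip k A B (Algebra.TensorProduct.map (idCounit k A B) (idCounit k A B) F.val ⊗ₜ[k]
        Algebra.TensorProduct.map (counitId k A B) (counitId k A B) F.val) *
      Bialgebra.comulAlgHom k (A ⊗[k] B) (outer k A B F.val) := by
  have h := congrArg (fun t ↦ middleFlip k A B (outer4 k A B t))
    (hF.middleFlip_cocycle4 (isTriangularStructure_flipUnit hS hT))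
  -- Each R-matrix loses one leg to a counit, so the factor `R₂₃` in the flipped fourfold identity
  -- disappears.
  have hR : outer k A B (flipUnit S T).val = 1 := by
    refine (outer_middleFlip S.val T.val).trans ?_
    rw [hS.idCounit_eq, hT.counitId_eq, Algebra.TensorProduct.one_def]
  -- After the flips the left side involves `outer ⊗ outer`, which undoes `Δ ⊗ Δ` and returns `F`
  -- itself.
  have hΔ : Algebra.TensorProduct.map (outer k A B) (outer k A B)
      (comulComul k (A ⊗[k] B) F.val) = F.val :=
    algHom_ext2 (φ := (Algebra.TensorProduct.map (outer k A B) (outer k A B)).comp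
      (comulComul k (A ⊗[k] B))) (ψ := AlgHom.id k _) (fun x y ↦ by
        simp only [AlgHom.comp_apply, comulComul, Algebra.TensorProduct.map_tmul]
        rw [outer_comul, outer_comul, AlgHom.id_apply]) F.val
  rw [map_mul (outer4 k A B), map_mul (middleFlip k A B), middleFlip_outer4_middleFlip, outer4_mid,
    hR, map_one, map_one, mul_one, map_mul, hΔ, Algebra.TensorProduct.map_tmul,
    map_mul (outer4 k A B), map_mul (middleFlip k A B), map_mul (outer4 k A B),
    map_mul (middleFlip k A B), outer4_comulComul, outer4_mid, ← mul_assoc] at h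
  exact h

lemma outer_map {C : Type u} [Ring C] [Bialgebra k C] (f : C →ₐ[k] A ⊗[k] B) (T : C ⊗[k] C) :
    outer k A B (Algebra.TensorProduct.map f f T) =
      Algebra.TensorProduct.map ((idCounit k A B).comp f) ((counitId k A B).comp f) T :=
  algHom_ext2 (φ := (outer k A B).comp (Algebra.TensorProduct.map f f))
    (ψ := Algebra.TensorProduct.map ((idCounit k A B).comp f) ((counitId k A B).comp f))
    (fun _ _ ↦ rfl) T

end Components

/-! ### Every 1-cell into a tensor product is isomorphic to a pairing -/

section Comparison

variable {X Y Z : TwTr k}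

lemma pair_F_val (p : TwistedHom X Y) (q : TwistedHom X Z) : (pair p q).F.val =
    middleFlip k Y Z (mid k Y Z (Algebra.TensorProduct.map p.f q.f X.R.val)) *
      middleFlip k Y Z (p.F.val ⊗ₜ[k] q.F.val) := by
  have h : ∀ T : X ⊗[k] X, Algebra.TensorProduct.map (Algebra.TensorProduct.map p.f p.f)
      (Algebra.TensorProduct.map q.f q.f) (mid k X X T) =
        mid k Y Z (Algebra.TensorProduct.map p.f q.f T) :=
    algHom_ext2 (φ := (Algebra.TensorProduct.map (Algebra.TensorProduct.map p.f p.f)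
      (Algebra.TensorProduct.map q.f q.f)).comp (mid k X X))
      (ψ := (mid k Y Z).comp (Algebra.TensorProduct.map p.f q.f)) fun a b ↦ by simp [mid]
  rw [← h, ← map_middleFlip]
  rfl

/-- The image in `Y ⊗ Z`, under `(Id ⊗ ε) ⊗ (ε ⊗ Id)`, of the twist of a 1-cell into `Y ⊗ Z`. -/
def outerUnit (p : TwistedHom X (tensorObj Y Z)) : (Y ⊗[k] Z)ˣ :=
  Units.map (outer k Y Z : (Y ⊗[k] Z) ⊗[k] (Y ⊗[k] Z) →* Y ⊗[k] Z) p.F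

lemma idCounit_outerUnit (p : TwistedHom X (tensorObj Y Z)) :
    idCounit k Y Z (outerUnit p).val = 1 :=
  (idCounit_outer p.F.val).trans
    ((congrArg (idCounit k Y Z) p.isTwist.counit_right).trans (map_one (idCounit k Y Z)))

lemma counitId_outerUnit (p : TwistedHom X (tensorObj Y Z)) :
    counitId k Y Z (outerUnit p).val = 1 :=
  (counitId_outer p.F.val).trans
    ((congrArg (counitId k Y Z) p.isTwist.counit_left).trans (map_one (counitId k Y Z)))

/-- The 2-cell from a 1-cell into a tensor product to the pairing of its components. -/
def toPair (p : TwistedHom X (tensorObj Y Z)) :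
    Gauge p (pair (p.comp (fst Y Z)) (p.comp (snd Y Z))) where
  a := (outerUnit p).val
  counit_a := by
    refine (counit_idCounit Y Z (outerUnit p).val).symm.trans ?_
    rw [idCounit_outerUnit, map_one]
  gauge_twist := by
    refine (p.isTwist.outer_tmul_outer Y.isTriangular Z.isTriangular).trans ?_
    have h1 : (p.comp (fst Y Z)).F.val =
        Algebra.TensorProduct.map (idCounit k Y Z) (idCounit k Y Z) p.F.val :=
      mul_one (Algebra.TensorProduct.map (idCounit k Y Z) (idCounit k Y Z) p.F.val)
    have h2 : (p.comp (snd Y Z)).F.val =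
        Algebra.TensorProduct.map (counitId k Y Z) (counitId k Y Z) p.F.val :=
      mul_one (Algebra.TensorProduct.map (counitId k Y Z) (counitId k Y Z) p.F.val)
    -- Compatibility of `p` with the R-matrices identifies the middle factor `F^op R F⁻¹` with the
    -- image of `X.R`, and `outer` turns this into the twist coming from the diagonal.
    have h3 := (congrArg (outer k Y Z) p.map_R).symm.trans (outer_map p.f X.R.val)
    rw [pair_F_val, h1, h2]
    exact congrArg (fun t ↦ middleFlip k Y Z (mid k Y Z t) *
      middleFlip k Y Z (Algebra.TensorProduct.map (idCounit k Y Z) (idCounit k Y Z) p.F.val ⊗ₜ[k]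
        Algebra.TensorProduct.map (counitId k Y Z) (counitId k Y Z) p.F.val) *
      Bialgebra.comulAlgHom k (Y ⊗[k] Z) (outer k Y Z p.F.val)) h3
  gauge_hom x := by
    -- Apply `outer` to `F Δ(f x) = (f ⊗ f)(Δ x) F`: on the left it cancels `Δ`, on the right it
    -- produces the two components of `f`.
    have h := congrArg (outer k Y Z) ((Units.mul_inv_eq_iff_eq_mul _).1 (p.comul_comp x))
    have h1 := outer_comul (k := k) (A := Y) (B := Z) (p.f x)
    have h2 := outer_map (A := Y) (B := Z) p.f (Bialgebra.comulAlgHom k X x)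
    exact (congrArg (outer k Y Z p.F.val * ·) h1).symm.trans ((map_mul (outer k Y Z) _ _).symm.trans
      (h.trans ((map_mul (outer k Y Z) _ _).trans (congrArg (· * outer k Y Z p.F.val) h2))))

lemma idCounit_map_map {A B C D : Type u} [Ring A] [Ring B] [Ring C] [Ring D] [Bialgebra k A]
    [Bialgebra k B] [Bialgebra k C] [Bialgebra k D] (f : A →ₐ[k] C) (g : B →ₐ[k] D)
    (hg : ∀ x, Bialgebra.counitAlgHom k D (g x) = Bialgebra.counitAlgHom k B x) (T : A ⊗[k] B) :
    idCounit k C D (Algebra.TensorProduct.map f g T) = f (idCounit k A B T) := by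
  simp only [Bialgebra.counitAlgHom_apply] at hg
  exact algHom_ext2 (φ := (idCounit k C D).comp (Algebra.TensorProduct.map f g))
    (ψ := f.comp (idCounit k A B)) (fun a b ↦ by simp [idCounit, hg]) T

lemma counitId_map_map {A B C D : Type u} [Ring A] [Ring B] [Ring C] [Ring D] [Bialgebra k A]
    [Bialgebra k B] [Bialgebra k C] [Bialgebra k D] (f : A →ₐ[k] C) (g : B →ₐ[k] D)
    (hf : ∀ x, Bialgebra.counitAlgHom k C (f x) = Bialgebra.counitAlgHom k A x) (T : A ⊗[k] B) :
    counitId k C D (Algebra.TensorProduct.map f g T) = g (counitId k A B T) := by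
  simp only [Bialgebra.counitAlgHom_apply] at hf
  exact algHom_ext2 (φ := (counitId k C D).comp (Algebra.TensorProduct.map f g))
    (ψ := g.comp (counitId k A B)) (fun a b ↦ by simp [counitId, hf]) T

/-- The projection applies a counit to one leg of `R` and to both legs of the twist of `q`. These
contribute `1`, leaving the twist of `p`, so the equality is strict. -/
lemma pair_fst (p : TwistedHom X Y) (q : TwistedHom X Z) : (pair p q).comp (fst Y Z) = p := by
  ext1
  · ext x
    refine (idCounit_map_map p.f q.f q.counit_comp (Bialgebra.comulAlgHom k X x)).trans ?_
    rw [idCounit_comul]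
  · ext1
    have h : ∀ T : Y ⊗[k] Z, Algebra.TensorProduct.map (idCounit k Y Z) (idCounit k Y Z)
        (middleFlip k Y Z (mid k Y Z T)) = 1 ⊗ₜ[k] idCounit k Y Z T :=
      algHom_ext2 (φ := (Algebra.TensorProduct.map (idCounit k Y Z) (idCounit k Y Z)).comp
        ((middleFlip k Y Z).comp (mid k Y Z)))
        (ψ := Algebra.TensorProduct.includeRight.comp (idCounit k Y Z)) fun a b ↦ by
          simp [mid, middleFlip, idCounit, TensorProduct.smul_tmul']
    refine (mul_one (Algebra.TensorProduct.map (idCounit k Y Z) (idCounit k Y Z)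
      (pair p q).F.val)).trans ?_
    rw [pair_F_val]
    refine (map_mul (Algebra.TensorProduct.map (idCounit k Y Z) (idCounit k Y Z)) _ _).trans ?_
    rw [h, idCounit_map_map p.f q.f q.counit_comp, X.isTriangular.idCounit_eq, map_one,
      ← Algebra.TensorProduct.one_def, one_mul, idCounit_flip, q.isTwist.counit_right, map_one,
      one_smul]

lemma pair_snd (p : TwistedHom X Y) (q : TwistedHom X Z) : (pair p q).comp (snd Y Z) = q := by
  ext1
  · ext x
    refine (counitId_map_map p.f q.f p.counit_comp (Bialgebra.comulAlgHom k X x)).trans ?_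
    rw [counitId_comul]
  · ext1
    have h : ∀ T : Y ⊗[k] Z, Algebra.TensorProduct.map (counitId k Y Z) (counitId k Y Z)
        (middleFlip k Y Z (mid k Y Z T)) = counitId k Y Z T ⊗ₜ[k] 1 :=
      algHom_ext2 (φ := (Algebra.TensorProduct.map (counitId k Y Z) (counitId k Y Z)).comp
        ((middleFlip k Y Z).comp (mid k Y Z)))
        (ψ := Algebra.TensorProduct.includeLeft.comp (counitId k Y Z)) fun a b ↦ by
          simp [mid, middleFlip, counitId, TensorProduct.smul_tmul']
    refine (mul_one (Algebra.TensorProduct.map (counitId k Y Z) (counitId k Y Z)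
      (pair p q).F.val)).trans ?_
    rw [pair_F_val]
    refine (map_mul (Algebra.TensorProduct.map (counitId k Y Z) (counitId k Y Z)) _ _).trans ?_
    rw [h, counitId_map_map p.f q.f p.counit_comp, X.isTriangular.counitId_eq, map_one,
      ← Algebra.TensorProduct.one_def, one_mul, counitId_flip, p.isTwist.counit_right, map_one,
      one_smul]

/-- Naturality of `toPair`, obtained by applying `outer` to `(a ⊗ a) F = F' Δ(a)`. -/
lemma outerUnit_mul_gauge {p q : TwistedHom X (tensorObj Y Z)} (a : Gauge p q) :
    HMul.hMul (α := Y ⊗[k] Z) (β := Y ⊗[k] Z) (outerUnit q).val a.a =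
      (idCounit k Y Z a.a ⊗ₜ[k] counitId k Y Z a.a) * (outerUnit p).val :=
  ((map_mul (outer k Y Z) _ _).symm.trans ((congrArg (outer k Y Z) a.gauge_twist).trans
    ((map_mul (outer k Y Z) _ _).trans (congrArg (outer k Y Z q.F.val * ·)
      (outer_comul (k := k) (A := Y) (B := Z) a.a))))).symm

lemma Gauge.ext_of_components {p q : TwistedHom X (tensorObj Y Z)} {a b : Gauge p q}
    (h1 : idCounit k Y Z a.a = idCounit k Y Z b.a)
    (h2 : counitId k Y Z a.a = counitId k Y Z b.a) : a = b := by
  have h := outerUnit_mul_gauge a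
  rw [h1, h2, ← outerUnit_mul_gauge b] at h
  exact Gauge.ext ((outerUnit q).mul_right_inj.1 h)

/-- The 2-cell into a tensor product with given components. -/
def gaugeOfComponents {p q : TwistedHom X (tensorObj Y Z)}
    (a : Gauge (p.comp (fst Y Z)) (q.comp (fst Y Z)))
    (b : Gauge (p.comp (snd Y Z)) (q.comp (snd Y Z))) : Gauge p q :=
  -- Conjugation by the comparison 2-cells. Only these need be invertible; `a` and `b` are
  -- arbitrary.
  ((toPair p).vcomp (pairGauge a b)).vcomp ((toPair q).inv (outerUnit q) rfl)

lemma gaugeOfComponents_a {p q : TwistedHom X (tensorObj Y Z)}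
    (a : Gauge (p.comp (fst Y Z)) (q.comp (fst Y Z)))
    (b : Gauge (p.comp (snd Y Z)) (q.comp (snd Y Z))) : (gaugeOfComponents a b).a =
      (outerUnit q)⁻¹.val * (a.a ⊗ₜ[k] b.a * (outerUnit p).val) := by
  rw [← pairGauge_a]
  rfl

lemma idCounit_gaugeOfComponents {p q : TwistedHom X (tensorObj Y Z)}
    (a : Gauge (p.comp (fst Y Z)) (q.comp (fst Y Z)))
    (b : Gauge (p.comp (snd Y Z)) (q.comp (snd Y Z))) :
    idCounit k Y Z (gaugeOfComponents a b).a = a.a := by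
  have h := congrArg (idCounit k Y Z) (outerUnit q).inv_mul
  rw [map_mul, idCounit_outerUnit, mul_one, map_one] at h
  have hb : Coalgebra.counit (R := k) b.a = (1 : k) := b.counit_a
  rw [gaugeOfComponents_a, map_mul, map_mul, h, idCounit_outerUnit, one_mul, mul_one]
  simp [idCounit, hb]

lemma counitId_gaugeOfComponents {p q : TwistedHom X (tensorObj Y Z)}
    (a : Gauge (p.comp (fst Y Z)) (q.comp (fst Y Z)))
    (b : Gauge (p.comp (snd Y Z)) (q.comp (snd Y Z))) :
    counitId k Y Z (gaugeOfComponents a b).a = b.a := by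
  have h := congrArg (counitId k Y Z) (outerUnit q).inv_mul
  rw [map_mul, counitId_outerUnit, mul_one, map_one] at h
  have ha : Coalgebra.counit (R := k) a.a = (1 : k) := a.counit_a
  rw [gaugeOfComponents_a, map_mul, map_mul, h, counitId_outerUnit, one_mul, mul_one]
  simp [counitId, ha]

end Comparison

/-! ### The binary product -/

lemma whiskerRight_a {X Y Z : TwTr k} {p q : X ⟶ Y} (a : p ⟶ q) (r : Y ⟶ Z) :
    Gauge.a (Bicategory.whiskerRight a r) = TwistedHom.f r (Gauge.a a) :=
  one_mul (TwistedHom.f r (Gauge.a a))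

lemma isBinaryProduct_tensorObj (Y Z : TwTr k) : IsBinaryProduct (fst Y Z) (snd Y Z) := by
  intro X
  let Φ := (Bicategory.postcomp X (fst Y Z)).prod' (Bicategory.postcomp X (snd Y Z))
  have map_fst : ∀ {p q : X ⟶ tensorObj Y Z} (a : p ⟶ q),
      Gauge.a (Φ.map a).1 = idCounit k Y Z (Gauge.a a) := fun a ↦ whiskerRight_a a (fst Y Z)
  have map_snd : ∀ {p q : X ⟶ tensorObj Y Z} (a : p ⟶ q),
      Gauge.a (Φ.map a).2 = counitId k Y Z (Gauge.a a) := fun a ↦ whiskerRight_a a (snd Y Z)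
  have hfaithful : Φ.Faithful := ⟨fun {p q a b} h ↦ Gauge.ext_of_components
    ((map_fst a).symm.trans ((congrArg (fun t ↦ Gauge.a t.1) h).trans (map_fst b)))
    ((map_snd a).symm.trans ((congrArg (fun t ↦ Gauge.a t.2) h).trans (map_snd b)))⟩
  have hfull : Φ.Full := ⟨fun {p q} c ↦ ⟨gaugeOfComponents c.1 c.2, Prod.ext
    (Gauge.ext ((map_fst _).trans (idCounit_gaugeOfComponents c.1 c.2)))
    (Gauge.ext ((map_snd _).trans (counitId_gaugeOfComponents c.1 c.2)))⟩⟩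
  have hsurj : Φ.EssSurj := ⟨fun c ↦ ⟨pair c.1 c.2,
    ⟨eqToIso (Prod.ext (pair_fst c.1 c.2) (pair_snd c.1 c.2))⟩⟩⟩
  exact { }

/-! ### The terminal object -/

variable (k) in
-- Over `k` this map is the canonical isomorphism `k ⊗ k ≅ k`, so identities in `k ⊗ k`, including
-- the triviality of every twist, can be tested after applying a counit.
lemma counitId_self_injective : Function.Injective (counitId k k k) := by
  have h : ∀ T : k ⊗[k] k, counitId k k k T = Algebra.TensorProduct.lid k k T :=
    algHom_ext2 (φ := counitId k k k) (ψ := (Algebra.TensorProduct.lid k k).toAlgHom)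
      fun a b ↦ by simp [counitId]
  exact fun S T hST ↦ (Algebra.TensorProduct.lid k k).injective ((h S).symm.trans (hST.trans (h T)))

/-- The 1-cell `X → k` given by the counit. -/
def toUnit (X : TwTr k) : TwistedHom X (unitObj k) where
  f := Bialgebra.counitAlgHom k X
  F := 1
  isTwist := isTwist_one k k
  counit_comp x := rfl
  comul_comp x := by
    refine (Units.mul_inv_eq_iff_eq_mul _).2 ?_
    rw [Units.val_one, one_mul, mul_one]
    refine counitId_self_injective k ((counitId_comul (k := k) (A := k) _).trans ?_)
    exact ((counitId_map (B := k) (Bialgebra.counitAlgHom k X) (fun _ ↦ rfl) _).trans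
      (congrArg _ (counitId_comul x))).symm
  map_R := by
    refine counitId_self_injective k ((counitId_map (B := k) (Bialgebra.counitAlgHom k X)
      (fun _ ↦ rfl) _).trans ?_)
    rw [X.isTriangular.counitId_eq, map_one]
    change _ = counitId k k k (op k k 1 * 1 * 1)
    rw [map_one, one_mul, one_mul, map_one]

lemma eq_toUnit {X : TwTr k} (p : TwistedHom X (unitObj k)) : p = toUnit X := by
  ext1
  · ext x
    exact p.counit_comp x
  · ext1
    exact counitId_self_injective k (p.isTwist.counit_left.trans (map_one (counitId k k k)).symm)

lemma isTerminalObject_unitObj : IsTerminalObject (unitObj k) := by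
  intro X
  let Φ := Functor.star.{0} (X ⟶ unitObj k)
  have hfaithful : Φ.Faithful := ⟨fun {p q a b} _ ↦
    Gauge.ext ((Gauge.counit_a a).trans (Gauge.counit_a b).symm)⟩
  have hfull : Φ.Full := ⟨fun {p q} c ↦
    ⟨eqToHom ((eq_toUnit p).trans (eq_toUnit q).symm), Subsingleton.elim _ _⟩⟩
  have hsurj : Φ.EssSurj := ⟨fun c ↦ ⟨toUnit X, ⟨eqToIso (Subsingleton.elim _ _)⟩⟩⟩
  exact { }

/-! ### From terminal and binary products to finite products -/

section Products

universe v₁ v₂ v₃ u₁ u₂ u₃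

variable {C : Type u₁} [Category.{v₁} C]

/-- Serves to reindex a product along a bijection. Surjectivity suffices: each component over `κ` is
read off at some preimage in `ι`. -/
lemma isEquivalence_pi'_of_comp_surjective {ι κ : Type*} (e : ι → κ)
    (he : Function.Surjective e) {D : κ → Type u₂} [∀ j, Category.{v₂} (D j)] (F : ∀ j, C ⥤ D j)
    [(Functor.pi' fun i ↦ F (e i)).IsEquivalence] : (Functor.pi' F).IsEquivalence := by
  have hfaithful : (Functor.pi' F).Faithful := ⟨fun {X Y a b} h ↦
    (Functor.pi' fun i ↦ F (e i)).map_injective (funext fun i ↦ congrFun h (e i))⟩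
  have hfull : (Functor.pi' F).Full := ⟨fun {X Y} c ↦ by
    obtain ⟨a, ha⟩ := (Functor.pi' fun i ↦ F (e i)).map_surjective fun i ↦ c (e i)
    refine ⟨a, funext fun j ↦ ?_⟩
    obtain ⟨i, rfl⟩ := he j
    exact congrFun ha i⟩
  have hsurj : (Functor.pi' F).EssSurj := ⟨fun Y ↦ by
    let Y' : ∀ i, D (e i) := fun i ↦ Y (e i)
    let X := (Functor.pi' fun i ↦ F (e i)).objPreimage Y'
    let φ : (Functor.pi' fun i ↦ F (e i)).obj X ≅ Y' := Functor.objObjPreimageIso _ Y'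
    have h : ∀ j, Nonempty ((F j).obj X ≅ Y j) := fun j ↦ by
      obtain ⟨i, rfl⟩ := he j
      exact ⟨Pi.isoApp φ i⟩
    exact ⟨X, ⟨Pi.isoMk fun j ↦ (h j).some⟩⟩⟩
  exact { }

/-- The inductive step at the level of functors. The family is allowed to agree with `G` and `H ⋙ K
i` only up to natural isomorphism, because postcomposition in a bicategory respects composites only
up to associators. -/
lemma isEquivalence_pi'_option {ι : Type*} {D : Option ι → Type u₂} [∀ j, Category.{v₂} (D j)]
    {E : Type u₃} [Category.{v₃} E] (G : C ⥤ D none) (H : C ⥤ E) (K : ∀ i, E ⥤ D (some i))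
    [(G.prod' H).IsEquivalence] [(Functor.pi' K).IsEquivalence] (F : ∀ j, C ⥤ D j)
    (e₀ : F none ≅ G) (e : ∀ i, F (some i) ≅ H ⋙ K i) : (Functor.pi' F).IsEquivalence := by
  have hfaithful : (Functor.pi' F).Faithful := ⟨fun {X Y a b} h ↦ by
    refine (G.prod' H).map_injective (Prod.ext ?_ ?_)
    · exact (NatIso.naturality_1 e₀ a).symm.trans ((congrArg
        (fun t ↦ e₀.inv.app X ≫ t ≫ e₀.hom.app Y) (congrFun h none)).trans
        (NatIso.naturality_1 e₀ b))
    · refine (Functor.pi' K).map_injective (funext fun i ↦ ?_)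
      exact (NatIso.naturality_1 (e i) a).symm.trans ((congrArg
        (fun t ↦ (e i).inv.app X ≫ t ≫ (e i).hom.app Y) (congrFun h (some i))).trans
        (NatIso.naturality_1 (e i) b))⟩
  have hfull : (Functor.pi' F).Full := ⟨fun {X Y} (c : ∀ j, (F j).obj X ⟶ (F j).obj Y) ↦ by
    obtain ⟨b, hb⟩ := (Functor.pi' K).map_surjective (X := H.obj X) (Y := H.obj Y)
      fun i ↦ (e i).inv.app X ≫ c (some i) ≫ (e i).hom.app Y
    obtain ⟨a, ha⟩ := (G.prod' H).map_surjective (X := X) (Y := Y)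
      (e₀.inv.app X ≫ c none ≫ e₀.hom.app Y, b)
    refine ⟨a, funext fun j ↦ ?_⟩
    cases j with
    | none =>
      have h : G.map a = _ := congrArg Prod.fst ha
      refine (NatIso.naturality_2 e₀ a).symm.trans ?_
      simp [h]
    | some i =>
      have h : H.map a = b := congrArg Prod.snd ha
      have h' := (NatIso.naturality_1 (e i) a).trans ((congrArg (K i).map h).trans (congrFun hb i))
      exact (cancel_mono ((e i).hom.app Y)).1 ((cancel_epi ((e i).inv.app X)).1 h')⟩
  have hsurj : (Functor.pi' F).EssSurj := ⟨fun Y ↦ by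
    let Y' : ∀ i, D (some i) := fun i ↦ Y (some i)
    let Z := (Functor.pi' K).objPreimage Y'
    let φ : (Functor.pi' K).obj Z ≅ Y' := Functor.objObjPreimageIso _ Y'
    let X := (G.prod' H).objPreimage (Y none, Z)
    let ψ : (G.prod' H).obj X ≅ (Y none, Z) := Functor.objObjPreimageIso _ _
    refine ⟨X, ⟨Pi.isoMk fun j ↦ ?_⟩⟩
    cases j with
    | none => exact e₀.app X ≪≫ (CategoryTheory.Prod.fst _ _).mapIso ψ
    | some i =>
      exact (e i).app X ≪≫ (K i).mapIso ((CategoryTheory.Prod.snd _ _).mapIso ψ) ≪≫ Pi.isoApp φ i⟩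
  exact { }

lemma hasFiniteProducts_of_terminal_of_binary {B : Type*} [Bicategory B] {T : B}
    (hT : IsTerminalObject T)
    (h : ∀ X Y : B, ∃ (P : B) (p : P ⟶ X) (q : P ⟶ Y), IsBinaryProduct p q) :
    HasFiniteProducts.{w} B := by
  intro ι _
  induction ι using Finite.induction_empty_option with
  | of_equiv e ih =>
    intro A
    obtain ⟨P, π, hπ⟩ := ih fun i ↦ A (e i)
    -- Presenting `π` as the restriction of a family on the new index type avoids transporting
    -- 1-cells along equalities of indices.
    obtain ⟨σ, rfl⟩ : ∃ σ : ∀ j, P ⟶ A j, π = fun i ↦ σ (e i) :=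
      ⟨(e.piCongrLeft fun j ↦ P ⟶ A j) π, funext fun i ↦
        (Equiv.piCongrLeft_apply_apply (fun j ↦ P ⟶ A j) e π i).symm⟩
    refine ⟨P, σ, fun X ↦ ?_⟩
    have := hπ X
    exact isEquivalence_pi'_of_comp_surjective e e.surjective fun j ↦ Bicategory.postcomp X (σ j)
  | h_empty =>
    intro A
    refine ⟨T, fun i ↦ i.elim, fun X ↦ ?_⟩
    have := hT X
    have hfaithful : (Functor.pi' fun i : PEmpty ↦ Bicategory.postcomp X
        (i.elim : T ⟶ A i)).Faithful :=
      ⟨fun {f g a b} _ ↦ (Functor.star.{0} (X ⟶ T)).map_injective (Subsingleton.elim _ _)⟩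
    have hfull : (Functor.pi' fun i : PEmpty ↦ Bicategory.postcomp X
        (i.elim : T ⟶ A i)).Full :=
      ⟨fun {f g} _ ↦ ⟨(Functor.star.{0} (X ⟶ T)).preimage (eqToHom rfl),
        funext fun i ↦ i.elim⟩⟩
    have hsurj : (Functor.pi' fun i : PEmpty ↦ Bicategory.postcomp X
        (i.elim : T ⟶ A i)).EssSurj :=
      ⟨fun _ ↦ ⟨(Functor.star.{0} (X ⟶ T)).objPreimage ⟨⟨⟩⟩, ⟨Pi.isoMk fun i ↦ i.elim⟩⟩⟩
    exact { }
  | h_option ih =>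
    intro A
    obtain ⟨Q, π, hπ⟩ := ih fun i ↦ A (some i)
    obtain ⟨P, p, q, hpq⟩ := h (A none) Q
    -- The new object is the binary product of `A none` with the product `Q` of the remaining
    -- objects, projected further through `Q`.
    let σ : ∀ j, P ⟶ A j := fun j ↦ j.rec p fun i ↦ q ≫ π i
    refine ⟨P, σ, fun X ↦ ?_⟩
    have := hπ X
    have := hpq X
    exact isEquivalence_pi'_option (Bicategory.postcomp X p) (Bicategory.postcomp X q)
      (fun i ↦ Bicategory.postcomp X (π i)) (fun j ↦ Bicategory.postcomp X (σ j)) (Iso.refl _)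
      fun i ↦ NatIso.ofComponents (F := Bicategory.postcomp X (q ≫ π i))
        (G := Bicategory.postcomp X q ⋙ Bicategory.postcomp X (π i))
        (fun f ↦ (Bicategory.associator f q (π i)).symm)
        fun f ↦ Bicategory.associator_inv_naturality_left f q (π i)

end Products

end TwistedTriangular

end

theorem mainTheorem9 (k : Type u) [Field k] :
    TwistedTriangular.HasFiniteProducts.{w} (TwistedTriangular.TwTr k) ∧
    TwistedTriangular.IsTerminalObject (TwistedTriangular.unitObj k) ∧
    ∀ X Y : TwistedTriangular.TwTr k,
      TwistedTriangular.IsBinaryProduct (TwistedTriangular.fst X Y)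
        (TwistedTriangular.snd X Y) :=
  ⟨TwistedTriangular.hasFiniteProducts_of_terminal_of_binary
    TwistedTriangular.isTerminalObject_unitObj fun X Y ↦
      ⟨_, _, _, TwistedTriangular.isBinaryProduct_tensorObj X Y⟩,
    TwistedTriangular.isTerminalObject_unitObj, TwistedTriangular.isBinaryProduct_tensorObj⟩
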